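/- Let $\Sigma$ be a finite alphabet and $V$ a set of variables. An extended variable-set automaton (eVA) $\mathcal A=(Q,q_0,F,\delta)$ has finitely many states $Q$, an initial state $q_0$, final states $F$, and a finite set $\delta$ of letter transitions $(q,a,q')$, $a\in\Sigma$, and variable transitions $(q,S,q')$ with $S$ a nonempty finite set of markers $\vdash_x,\dashv_x$ ($x\in V$, opening and closing $x$); $|\mathcal A|$ is the number of states plus the number of transitions, and $\mathrm{var}(\mathcal A)$ is the set of variables that occur in $\delta$. A run over $d=a_1\cdots a_n$ is a sequence $\rho = q_0\xrightarrow{S_1}p_0\xrightarrow{a_1}q_1\xrightarrow{S_2}p_1\cdots\xrightarrow{a_n}q_n\xrightarrow{S_{n+1}}p_n$ with $(p_{i},a_{i+1},q_{i+1})\in\delta$ and, for each $i$, either $(q_i,S_{i+1},p_i)\in\delta$, or $S_{i+1}=\emptyset$ and $q_i=p_i$. It is accepting if $p_n\in F$, and valid if the $S_i$ are pairwise disjoint, each $\vdash_x\in S_i$ has some $\dashv_x\in S_j$ with $j\ge i$, and each $\dashv_x\in S_j$ has some $\vdash_x\in S_i$ with $i\le j$; a valid $\rho$ defines the mapping $\mu^\rho$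 with $\mu^\rho(x)=[i,j\rangle$ iff $\vdash_x\in S_i$, $\dashv_x\in S_j$ and $i\le j$. Let $[\![\mathcal A]\!]_d$ be the set of all $\mu^\rho$ for $\rho$ a valid accepting run over $d$, and let $\mathrm{Out}(\rho)$ be the sequence of the pairs $(S_j,j)$ with $S_j\neq\emptyset$, in increasing order of $j$; such a sequence $M$ encodes a mapping $\mu^M$. $\mathcal A$ is deterministic if $\delta$ is a partial function of the state and the label, and sequential if every accepting run over every document is valid. The algorithm keeps a singly linked list $list_q$ for every $q\in Q$, whose elements are nodes: the sink $\bot$, or a node with a content $(S,i)$ and a list of nodes. Lists are given by pointers to their first and last element. Initially $list_{q_0}=[\bot]$ and $list_q=\varepsilon$ for $q\ne q_0$. $\mathrm{Capturing}(i)$ first saves (copies of the pointers of) all lists as $list^{old}_q$; then, for every $q$ with $list_q^{old}\neq\varepsilon$ and every $(q,S,p)\in\delta$, it adds at the front of $list_p$ a new node with content $(S,i)$ and list $list_q^{old}$. $\mathrm{Reading}(i)$ saves all lists as $list_q^{old}$, sets all $list_q$ to $\varepsilon$, and then, for every $q$ with $list_q^{old}\ne\varepsilon$ for which $p=\delta(q,a_i)$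 is defined, appends $list_q^{old}$ to $list_p$ by redirecting one pointer. Evaluate performs $\mathrm{Capturing}(1),\mathrm{Reading}(1),\dots,\mathrm{Capturing}(n),\mathrm{Reading}(n),\mathrm{Capturing}(n+1)$, and then selects the final states $q$ with $list_q\neq\varepsilon$. Enumerate then calls $\mathrm{EnumAll}(list_q,\varepsilon)$ for each selected $q$, where $\mathrm{EnumAll}(l,M)$ goes through the nodes of $l$, outputs $M$ at $\bot$, and calls $\mathrm{EnumAll}(l',(S,i)\cdot M)$ at a node with content $(S,i)$ and list $l'$. Theorem. There is an absolute constant $c$ such that for every deterministic sequential eVA $\mathcal A$ and every document $d=a_1\cdots a_n$, whatever the orders in which the states, final states and transitions are listed in the input: 1. Evaluate (including the selection of the final states with nonempty list) makes at most $c\,|\mathcal A|\,(|d|+1)$ steps, where every list operation, node creation, pointer assignment, test, and reading of a transition counts as a bounded number of steps. 2. For every $0\le i\le n$, every $p\in Q$ and every sequence $M$: there is a run $\rho$ of $\mathcal A$ over $a_1\cdots a_i$ that ends in $p_i=p$ and has $\mathrm{Out}(\rho)=M$ if and only if, after $\mathrm{Capturing}(i+1)$, $list_p\neq\varepsilon$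 and the (terminating) call $\mathrm{EnumAll}(list_p,\varepsilon)$ has $M$ among its outputs. 3. Enumerate terminates, and its outputs, read as mappings, are exactly the elements of $[\![\mathcal A]\!]_d$, each of them produced exactly once. The time before the first output, between any two consecutive outputs, and from the last output to the end is at most $c\,(|\mathrm{var}(\mathcal A)|+1)$, including the time for writing the outputs. -/

import Mathlib

namespace Spanner

universe u v w

/-! ### Spans, mappings, markers -/

/-- A span `[lo, hi⟩` with `1 ≤ lo ≤ hi`. -/
@[ext]
structure Span where
  lo : ℕ
  hi : ℕ
  one_le : 1 ≤ lo
  le : lo ≤ hi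

/-- A mapping: a function from a finite set of variables to spans. -/
@[ext]
structure SMapping (V : Type v) where
  toFun : V → Option Span
  finite_dom : {x | toFun x ≠ none}.Finite

/-- The variable markers: `opn x` opens the variable `x`, `cls x` closes it. -/
inductive Marker (V : Type v) where
  | opn (x : V)
  | cls (x : V)
  deriving DecidableEq

/-- The variable of a marker. -/
def Marker.var {V : Type v} : Marker V → V
  | .opn x => x
  | .cls x => x

/-- Sequences `(S₁, i₁) … (Sₘ, iₘ)` of sets of markers with positions. -/
abbrev MarkerSeq (V : Type v) := List (Finset (Marker V) × ℕ)

namespace MarkerSeq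

variable {V : Type v} [DecidableEq V]

/-- The position at which the marker `m` occurs in `M` (`none` if it does not occur). -/
def posOf (m : Marker V) (M : MarkerSeq V) : Option ℕ :=
  (M.find? (fun t => decide (m ∈ t.1))).map Prod.snd

/-- The span that `M` gives to the variable `x`, if `M` opens and then closes `x`. -/
def spanOf (M : MarkerSeq V) (x : V) : Option Span :=
  match posOf (.opn x) M, posOf (.cls x) M with
  | some i, some j => if h : 1 ≤ i ∧ i ≤ j then some ⟨i, j, h.1, h.2⟩ else none
  | _, _ => none

theorem exists_mem_of_spanOf_ne_none (M : MarkerSeq V) (x : V) (h : spanOf M x ≠ none) :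
    ∃ t ∈ M, Marker.opn x ∈ t.1 := by
  have h1 : posOf (.opn x) M ≠ none := by
    intro h0
    apply h
    simp [spanOf, h0]
  have h2 : M.find? (fun t => decide (Marker.opn x ∈ t.1)) ≠ none := by
    intro h0
    apply h1
    simp [posOf, h0]
  obtain ⟨t, ht⟩ := Option.ne_none_iff_exists'.1 h2
  refine ⟨t, List.mem_of_find?_eq_some ht, ?_⟩
  simpa using List.find?_some ht

/-- The mapping `μ^M` encoded by the sequence `M`. -/
def toMapping (M : MarkerSeq V) : SMapping V where
  toFun := spanOf M
  finite_dom := by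
    apply Set.Finite.subset
      ((M.toFinset.biUnion (fun t => t.1.image Marker.var)).finite_toSet)
    intro x hx
    obtain ⟨t, ht, hxt⟩ := exists_mem_of_spanOf_ne_none M x hx
    simp only [Finset.coe_biUnion, Set.mem_iUnion, Finset.mem_coe, List.mem_toFinset,
      Finset.mem_image]
    exact ⟨t, ht, _, hxt, rfl⟩

end MarkerSeq

/-! ### Extended variable-set automata -/

/-- An extended variable-set automaton over the alphabet `α`, with variables from `V` and
states `Q`: letter transitions `(q, a, q')` and extended variable transitions `(q, S, q')`
with `S` a nonempty (finite) set of markers. -/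
structure EVA (α : Type u) (V : Type v) (Q : Type w) where
  init : Q
  final : Finset Q
  letter : Finset (Q × α × Q)
  capture : Finset (Q × Finset (Marker V) × Q)
  capture_nonempty : ∀ t ∈ capture, t.2.1.Nonempty

namespace EVA

variable {α : Type u} {V : Type v} {Q : Type w}

/-- The size of an automaton: the number of states plus the number of transitions. -/
def size [Fintype Q] (A : EVA α V Q) : ℕ :=
  Fintype.card Q + (A.letter.card + A.capture.card)

/-- The variables that are mentioned in some transition. -/
def vars [DecidableEq V] (A : EVA α V Q) : Finset V :=
  A.capture.biUnion (fun t => t.2.1.image Marker.var)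

/-- The transition relation is a partial function of the state and the label. -/
def Deterministic (A : EVA α V Q) : Prop :=
  (∀ q a p p', (q, a, p) ∈ A.letter → (q, a, p') ∈ A.letter → p = p') ∧
  (∀ q S p p', (q, S, p) ∈ A.capture → (q, S, p') ∈ A.capture → p = p')

/-- A run `q₀ -S₁→ p₀ -a₁→ q₁ -S₂→ p₁ ⋯ -aₙ→ qₙ -Sₙ₊₁→ pₙ` over `w = a₁ ⋯ aₙ`. Only the
entries `q 0, …, q n`, `p 0, …, p n` and `S 1, …, S (n + 1)` are relevant. -/
structure Run (A : EVA α V Q) (w : List α) where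
  q : ℕ → Q
  p : ℕ → Q
  S : ℕ → Finset (Marker V)
  start : q 0 = A.init
  stay : ∀ i ≤ w.length, S (i + 1) = ∅ → q i = p i
  capture : ∀ i ≤ w.length, S (i + 1) ≠ ∅ → (q i, S (i + 1), p i) ∈ A.capture
  letter : ∀ i (h : i < w.length), (p i, w[i], q (i + 1)) ∈ A.letter

namespace Run

variable {A : EVA α V Q} {w : List α}

/-- The last state `pₙ` of a run. -/
def last (ρ : A.Run w) : Q := ρ.p w.length

def Accepting (ρ : A.Run w) : Prop := ρ.last ∈ A.final

/-- The variables are opened and closed in a correct manner. -/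
def Valid (ρ : A.Run w) : Prop :=
  (∀ i ∈ Set.Icc 1 (w.length + 1), ∀ j ∈ Set.Icc 1 (w.length + 1), i ≠ j →
    Disjoint (ρ.S i) (ρ.S j)) ∧
  (∀ x, ∀ i ∈ Set.Icc 1 (w.length + 1), Marker.opn x ∈ ρ.S i →
    ∃ j ∈ Set.Icc 1 (w.length + 1), i ≤ j ∧ Marker.cls x ∈ ρ.S j) ∧
  (∀ x, ∀ j ∈ Set.Icc 1 (w.length + 1), Marker.cls x ∈ ρ.S j →
    ∃ i ∈ Set.Icc 1 (w.length + 1), i ≤ j ∧ Marker.opn x ∈ ρ.S i)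

/-- `μ` is the mapping `μ^ρ`: it maps `x` to `[i, j⟩` if and only if `x` is opened in `Sᵢ` and
closed in `Sⱼ` (for a valid run there is exactly one such `μ`). -/
def Defines (ρ : A.Run w) (μ : SMapping V) : Prop :=
  ∀ (x : V) (s : Span), μ.toFun x = some s ↔
    s.hi ≤ w.length + 1 ∧ Marker.opn x ∈ ρ.S s.lo ∧ Marker.cls x ∈ ρ.S s.hi

/-- `Out(ρ)`: the pairs `(Sⱼ, j)` with `Sⱼ ≠ ∅`, in increasing order of `j`. -/
def out (ρ : A.Run w) : MarkerSeq V :=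
  ((List.range (w.length + 1)).map (fun k => (ρ.S (k + 1), k + 1))).filter
    (fun t => decide t.1.Nonempty)

end Run

/-- Every accepting run, over every document, is valid. -/
def Sequential (A : EVA α V Q) : Prop :=
  ∀ (d : List α) (ρ : A.Run d), ρ.Accepting → ρ.Valid

/-- The set of mappings `⟦A⟧_d`. -/
def sem (A : EVA α V Q) (d : List α) : Set (SMapping V) :=
  {μ | ∃ ρ : A.Run d, ρ.Valid ∧ ρ.Accepting ∧ ρ.Defines μ}

/-- The automaton as it is stored in the input: its states and final states are listed in some
order, and each state comes with the lists of its outgoing transitions, in some order. These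
orders are the ones in which the loops of the algorithm run. -/
structure Presentation (A : EVA α V Q) where
  states : List Q
  states_nodup : states.Nodup
  mem_states : ∀ q, q ∈ states
  finals : List Q
  finals_nodup : finals.Nodup
  mem_finals : ∀ q, q ∈ finals ↔ q ∈ A.final
  letterAdj : Q → List (α × Q)
  letterAdj_nodup : ∀ q, (letterAdj q).Nodup
  mem_letterAdj : ∀ q a p, (a, p) ∈ letterAdj q ↔ (q, a, p) ∈ A.letter
  captureAdj : Q → List (Finset (Marker V) × Q)
  captureAdj_nodup : ∀ q, (captureAdj q).Nodup
  mem_captureAdj : ∀ q S p, (S, p) ∈ captureAdj q ↔ (q, S, p) ∈ A.capture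

end EVA

/-! ### The memory: linked lists of nodes -/

/-- A list is a pair `(s, e)` of pointers to its first and its last element in a singly linked
list; `none` is the empty list `ε`. -/
abbrev PList := Option (ℕ × ℕ)

/-- A node of the reverse dual DAG: the sink `⊥`, or a node with content `(S, i)` and with the
list `l` of the nodes to which it has an edge. -/
inductive DagNode (V : Type v) where
  | bot
  | node (S : Finset (Marker V)) (i : ℕ) (l : PList)

/-- An element of a linked list: a node and a pointer to the next element (or null). -/
structure Cell (V : Type v) where
  payload : DagNode V
  next : Option ℕ

/-- The state of the machine: the memory cells (`none` if not allocated), the first free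
address, the variables `list_q` and `list_q^old`, and the number of steps made so far. Each
operation below makes a bounded number of accesses to the memory, and is charged for them. -/
structure State (V : Type v) (Q : Type w) where
  cells : ℕ → Option (Cell V)
  free : ℕ
  list : Q → PList
  old : Q → PList
  time : ℕ

namespace State

variable {V : Type v} {Q : Type w} [DecidableEq Q]

/-- Let `k` steps pass. -/
def tick (k : ℕ) (σ : State V Q) : State V Q := { σ with time := σ.time + k }

/-- `list_q ← ε` -/
def clear (q : Q) (σ : State V Q) : State V Q :=
  { σ with list := Function.update σ.list q none, time := σ.time + 1 }

/-- `list_q^old ← list_q.lazycopy`: only the pair of pointers is copied. -/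
def save (q : Q) (σ : State V Q) : State V Q :=
  { σ with old := Function.update σ.old q (σ.list q), time := σ.time + 1 }

/-- `list_p.add(n)`: a new element with payload `n` is put in front of `list_p`. -/
def add (p : Q) (n : DagNode V) (σ : State V Q) : State V Q :=
  { σ with
    cells := Function.update σ.cells σ.free (some ⟨n, (σ.list p).map Prod.fst⟩)
    free := σ.free + 1
    list := Function.update σ.list p
      (match σ.list p with
        | none => some (σ.free, σ.free)
        | some (_, e) => some (σ.free, e))
    time := σ.time + 1 }

/-- `list_p.append(l)`: the next pointer of the last element of `list_p` is set to the first
element of `l`. -/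
def append (p : Q) (l : PList) (σ : State V Q) : State V Q :=
  match σ.list p, l with
  | _, none => { σ with time := σ.time + 1 }
  | none, some l' =>
    { σ with list := Function.update σ.list p (some l'), time := σ.time + 1 }
  | some (s, e), some (s', e') =>
    { σ with
      cells := Function.update σ.cells e ((σ.cells e).map fun c => { c with next := some s' })
      list := Function.update σ.list p (some (s, e'))
      time := σ.time + 1 }

end State

/-! ### The preprocessing: procedure Evaluate -/

namespace EVA.Presentation

variable {α : Type u} {V : Type v} {Q : Type w} [DecidableEq α] [DecidableEq Q]
variable {A : EVA α V Q} (P : A.Presentation)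

/-- The initialisation: `list_q ← ε` for `q ≠ q₀`, and `list_{q₀} ← [⊥]`. -/
def initState : State V Q :=
  let blank : State V Q :=
    { cells := fun _ => none, free := 0, list := fun _ => none, old := fun _ => none, time := 0 }
  State.add A.init .bot
    (P.states.foldl (fun σ q => if q = A.init then σ.tick 1 else σ.clear q) blank)

/-- `Capturing(i)`. For each state there is one step for the test `list_q^old ≠ ε`, and for each
transition `(q, S, p)` from a live state `q` there are two steps for reading it and creating the
node, and one for adding the node to `list_p`. -/
def capturing (i : ℕ) (σ : State V Q) : State V Q :=
  P.states.foldl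
    (fun σ q =>
      if σ.old q = none then σ.tick 1
      else (P.captureAdj q).foldl
        (fun σ t => (σ.tick 2).add t.2 (.node t.1 i (σ.old q))) (σ.tick 1))
    (P.states.foldl (fun σ q => σ.save q) σ)

/-- `δ(q, a)`, found by scanning the letter transitions of `q`. -/
def next (q : Q) (a : α) : Option Q :=
  ((P.letterAdj q).find? (fun t => decide (t.1 = a))).map Prod.snd

/-- `Reading(i)`, where `a` is the `i`-th letter. For each state there is one step for the test
`list_q^old ≠ ε`; for a live state there is one step for each letter transition scanned in the
computation of `δ(q, a)`, and one for the list operation. If `δ(q, a)` is undefined, then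
`list_q^old` is dropped. -/
def reading (a : α) (σ : State V Q) : State V Q :=
  P.states.foldl
    (fun σ q =>
      if σ.old q = none then σ.tick 1
      else
        match P.next q a with
        | none => σ.tick (1 + (P.letterAdj q).length)
        | some p => (σ.tick (1 + (P.letterAdj q).length)).append p (σ.old q))
    (P.states.foldl (fun σ q => (σ.save q).clear q) σ)

/-- The state before `Capturing(i + 1)`, that is, after the first `i` rounds
`Capturing(1), Reading(1), …, Capturing(i), Reading(i)` of the main loop over `d`. -/
def rounds (d : List α) : ℕ → State V Q
  | 0 => P.initState
  | i + 1 =>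
    match d[i]? with
    | none => rounds d i
    | some a => (P.reading a (P.capturing (i + 1) (rounds d i))).tick 1

/-- The state after `Capturing(i + 1)`, for `0 ≤ i ≤ |d|`. -/
def afterCapturing (d : List α) (i : ℕ) : State V Q :=
  P.capturing (i + 1) (P.rounds d i)

/-- The final states with a nonempty list. -/
def liveFinals (σ : State V Q) : List Q :=
  P.finals.filter (fun q => decide (σ.list q ≠ none))

/-- The preprocessing phase: Evaluate up to its last step `Capturing(|d| + 1)`, and then the
selection of the final states `q` with `list_q ≠ ε` (one step for each final state). -/
def evaluate (d : List α) : State V Q × List Q :=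
  let σ := P.afterCapturing d d.length
  (σ.tick P.finals.length, P.liveFinals σ)

end EVA.Presentation

/-! ### The enumeration: procedures Enumerate and EnumAll -/

/-- An active call of EnumAll: the part of its list that is not yet visited, and the argument
`map`. -/
structure Frame (V : Type v) where
  rest : PList
  map : MarkerSeq V

/-- A configuration of Enumerate: the final states (with nonempty lists) not yet treated, and
the stack of the active calls of EnumAll, the innermost one first. -/
structure Config (V : Type v) (Q : Type w) where
  todo : List Q
  stack : List (Frame V)

/-- One event of the enumeration: the number of steps it takes, and the output it produces, if
any. -/
abbrev Event (V : Type v) := ℕ × Option (MarkerSeq V)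

/-- The time for writing down an output. -/
def writeTime {V : Type v} (M : MarkerSeq V) : ℕ := 1 + (M.map (fun t => 1 + t.1.card)).sum

/-- One move of Enumerate: calling EnumAll for the next final state, leaving a call of EnumAll
whose list is at its end, or one iteration of the loop of EnumAll. The latter takes the next
node from the list, and either produces an output or calls EnumAll recursively. There is no move
if the enumeration has ended (or if a dangling pointer is met). -/
def move {V : Type v} {Q : Type w} (σ : State V Q) : Config V Q → Option (Config V Q × Event V)
  | ⟨[], []⟩ => none
  | ⟨q :: todo, []⟩ => some (⟨todo, [⟨σ.list q, []⟩]⟩, (1, none))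
  | ⟨todo, ⟨none, _⟩ :: stack⟩ => some (⟨todo, stack⟩, (1, none))
  | ⟨todo, ⟨some (s, e), map⟩ :: stack⟩ =>
    match σ.cells s with
    | none => none
    | some c =>
      let frame : Frame V := ⟨if s = e then none else c.next.map (fun s' => (s', e)), map⟩
      match c.payload with
      | .bot => some (⟨todo, frame :: stack⟩, (1 + writeTime map, some map))
      | .node S i l => some (⟨todo, ⟨l, (S, i) :: map⟩ :: frame :: stack⟩, (1, none))

/-- `Trace σ c t`: the enumeration from the configuration `c` ends (with nothing left to do), and
`t` is the list of its events. -/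
inductive Trace {V : Type v} {Q : Type w} (σ : State V Q) : Config V Q → List (Event V) → Prop
  | halt : Trace σ ⟨[], []⟩ []
  | step {c c' : Config V Q} {e : Event V} {t : List (Event V)} :
      move σ c = some (c', e) → Trace σ c' t → Trace σ c (e :: t)

/-- The outputs, in the order in which they are produced. -/
def outputs {V : Type v} (t : List (Event V)) : List (MarkerSeq V) := t.filterMap Prod.snd

/-- The delays: the times up to the first output, between two consecutive outputs, and after the
last output, when `acc` steps have passed already. -/
def delays {V : Type v} (acc : ℕ) : List (Event V) → List ℕ
  | [] => [acc]
  | (k, none) :: t => delays (acc + k) t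
  | (k, some _) :: t => (acc + k) :: delays 0 t

/-- `M` is one of the outputs of the call `EnumAll(l, ε)` in the state `σ`. -/
def EnumAllOutputs {V : Type v} {Q : Type w} (σ : State V Q) (l : PList) (M : MarkerSeq V) :
    Prop :=
  ∃ t, Trace σ ⟨[], [⟨l, []⟩]⟩ t ∧ M ∈ outputs t

end Spanner

namespace Spanner

universe u v w

/-! ### Denotations of linked lists -/

/-! A linked list is interpreted as the sequence of outputs of EnumAll on it (`Denotes`), and
Evaluate is analysed on these sequences. The difficulty is aliasing: a saved list is a mere pair of
pointers, it shares cells with current lists and with lists stored in nodes, and Reading overwrites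
next pointers. This is harmless because a traversal stops at its end pointer without using the next
pointer found there. One keeps a set `B` of cells at which every list that reaches them stops.
Adding in front alters no existing cell. Appending redirects the end of a current list, a cell of
`B`, which then leaves `B` for good. For this the ends of the current lists must be distinct
(`State.Represents`), and Reading preserves this because each saved list is appended at most once.

On top of this, induction on the position shows that `list_q` contains, each once, the outputs of
the run prefixes that end in `q` (`Reach`, `CaptureStep`, `Lists`). There are no repetitions because
the position in the last pair tells whether a capture took place at the current position; in a
deterministic automaton the output therefore determines the state (`Reach.state_unique`). By
sequentiality, outputs at final states come from valid runs, and the output of a valid run can be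
recovered from its mapping (`Run.Valid.out_eq`), so distinct outputs give distinct mappings.

For the delay, lists stored in nodes are nonempty, so every recursive call leads to an output. The
depth is then bounded by the length of an output, which is at most twice the number of variables.
Between outputs the recursion only climbs and then descends (`Denotes.exists_trace`). Evaluate is
linear because each round handles every state and transition boundedly often. -/

/-- The part of the list `(s, e)` after its first element, whose next pointer is `nx`. -/
def restOf (s e : ℕ) (nx : Option ℕ) : PList :=
  if s = e then none else nx.map (fun s' => (s', e))

/-- `Denotes cells B l Ms`: the linked list `l` is well-formed and `Ms` are the outputs of
`EnumAll(l, ε)`, in order. The addresses in `B` are used only as ends of lists, so that their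
next pointers are irrelevant. -/
inductive Denotes {V : Type v} (cells : ℕ → Option (Cell V)) (B : Set ℕ) :
    PList → List (MarkerSeq V) → Prop
  | nil : Denotes cells B none []
  | bot {s e : ℕ} {nx : Option ℕ} {Ms : List (MarkerSeq V)} :
      cells s = some ⟨.bot, nx⟩ → (s ≠ e → s ∉ B ∧ nx ≠ none) →
      Denotes cells B (restOf s e nx) Ms → Denotes cells B (some (s, e)) ([] :: Ms)
  | node {s e : ℕ} {nx : Option ℕ} {S : Finset (Marker V)} {i : ℕ} {l : PList}
      {Ms₁ Ms₂ : List (MarkerSeq V)} :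
      cells s = some ⟨.node S i l, nx⟩ → (s ≠ e → s ∉ B ∧ nx ≠ none) → l ≠ none →
      Denotes cells B l Ms₁ → Denotes cells B (restOf s e nx) Ms₂ →
      Denotes cells B (some (s, e)) (Ms₁.map (· ++ [(S, i)]) ++ Ms₂)

/-- The outputs contributed by a single node. -/
def DagNode.Denotes {V : Type v} (cells : ℕ → Option (Cell V)) (B : Set ℕ) :
    DagNode V → List (MarkerSeq V) → Prop
  | .bot, Ms => Ms = [[]]
  | .node S i l, Ms => l ≠ none ∧ ∃ Ms₁, Spanner.Denotes cells B l Ms₁ ∧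
      Ms = Ms₁.map (· ++ [(S, i)])

namespace Denotes

variable {V : Type v} {cells cells' : ℕ → Option (Cell V)} {B B' : Set ℕ}

theorem cons {s e : ℕ} {n : DagNode V} {nx : Option ℕ} {Ms₁ Ms₂ : List (MarkerSeq V)}
    (hs : cells s = some ⟨n, nx⟩) (hne : s ≠ e → s ∉ B ∧ nx ≠ none)
    (hn : n.Denotes cells B Ms₁) (h : Denotes cells B (restOf s e nx) Ms₂) :
    Denotes cells B (some (s, e)) (Ms₁ ++ Ms₂) := by
  cases n with
  | bot =>
    cases hn
    exact .bot hs hne h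
  | node S i l =>
    obtain ⟨hl, Ms, hMs, rfl⟩ := hn
    exact .node hs hne hl hMs h

theorem eq_nil {Ms : List (MarkerSeq V)} (h : Denotes cells B none Ms) : Ms = [] := by
  cases h; rfl

/-- Stored lists are nonempty, so following them leads to the sink. This is what excludes dead ends
in the enumeration. -/
theorem ne_nil {l : PList} {Ms : List (MarkerSeq V)} (h : Denotes cells B l Ms)
    (hl : l ≠ none) : Ms ≠ [] := by
  induction h with
  | nil => exact absurd rfl hl
  | bot => simp
  | node _ _ hl₁ _ _ ih => simp [ih hl₁]

/-- A traversal uses payloads, and next pointers only of cells that it passes beyond; those lie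
outside `B`. The clause `a ∉ B'` says that an allocated cell never returns to the set of pure ends.
-/
theorem mono {l : PList} {Ms : List (MarkerSeq V)} (h : Denotes cells B l Ms)
    (hc : ∀ a c, cells a = some c → ∃ c', cells' a = some c' ∧ c'.payload = c.payload ∧
      (a ∉ B → c'.next = c.next ∧ a ∉ B')) :
    Denotes cells' B' l Ms := by
  have rest {s e : ℕ} {n : DagNode V} {nx : Option ℕ} (hs : cells s = some ⟨n, nx⟩)
      (hne : s ≠ e → s ∉ B ∧ nx ≠ none) : ∃ nx', cells' s = some ⟨n, nx'⟩ ∧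
        (s ≠ e → s ∉ B' ∧ nx' ≠ none) ∧ restOf s e nx' = restOf s e nx := by
    obtain ⟨⟨n', nx'⟩, h₁, h₂, h₃⟩ := hc _ _ hs
    cases h₂
    refine ⟨nx', h₁, fun h => ?_, ?_⟩
    · obtain ⟨h₄, h₅⟩ := hne h
      obtain ⟨h₆, h₇⟩ := h₃ h₄
      exact ⟨h₇, by rwa [show nx' = nx from h₆]⟩
    · by_cases hse : s = e
      · simp [restOf, hse]
      · have := (h₃ (hne hse).1).1
        simp only at this
        rw [this]
  induction h with
  | nil => exact .nil
  | bot hs hne _ ih =>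
    obtain ⟨nx', h₁, h₂, h₃⟩ := rest hs hne
    exact .bot h₁ h₂ (h₃ ▸ ih)
  | node hs hne hl _ _ ih₁ ih₂ =>
    obtain ⟨nx', h₁, h₂, h₃⟩ := rest hs hne
    exact .node h₁ h₂ hl ih₁ (h₃ ▸ ih₂)

/-- With the new end `e'` the traversal passes beyond `e` and continues in the second list. The
hypothesis `he'` prevents it from stopping early: cells of the first list before `e` are outside
`B`, hence different from `e'`. -/
theorem append {s e s' e' : ℕ} {Ms₁ Ms₂ : List (MarkerSeq V)}
    (h₁ : Denotes cells B (some (s, e)) Ms₁) (he' : e' ∈ B) (hee' : e ≠ e')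
    (hc : ∀ a c, cells a = some c → ∃ c', cells' a = some c' ∧ c'.payload = c.payload ∧
      (a ∉ B → c'.next = c.next ∧ a ∉ B'))
    (heB' : e ∉ B') (hnext : ∀ c, cells' e = some c → c.next = some s')
    (h₂ : Denotes cells' B' (some (s', e')) Ms₂) :
    Denotes cells' B' (some (s, e')) (Ms₁ ++ Ms₂) := by
  generalize hl : (some (s, e) : PList) = l at h₁
  -- Treats one cell of the first list, for both kinds of payload; `ih` covers the cells after it.
  have key {s₀ : ℕ} {n : DagNode V} {nx : Option ℕ} {Ms Ms₀ : List (MarkerSeq V)}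
      (hs : cells s₀ = some ⟨n, nx⟩) (hne : s₀ ≠ e → s₀ ∉ B ∧ nx ≠ none)
      (hr : Denotes cells B (restOf s₀ e nx) Ms)
      (ih : ∀ s, some (s, e) = restOf s₀ e nx → Denotes cells' B' (some (s, e')) (Ms ++ Ms₂))
      (hn : n.Denotes cells' B' Ms₀) :
      Denotes cells' B' (some (s₀, e')) (Ms₀ ++ (Ms ++ Ms₂)) := by
    obtain ⟨⟨n', nx'⟩, h₁, h₃, h₄⟩ := hc _ _ hs
    cases h₃
    by_cases hse : s₀ = e
    · subst hse
      obtain rfl : nx' = some s' := hnext _ h₁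
      have : Ms = [] := by
        rw [restOf, if_pos rfl] at hr
        exact hr.eq_nil
      subst this
      refine cons h₁ (fun _ => ⟨heB', by simp⟩) hn ?_
      simpa [restOf, hee'] using h₂
    · obtain ⟨h₅, h₆⟩ := hne hse
      obtain ⟨h₇, h₈⟩ := h₄ h₅
      obtain rfl : nx' = nx := h₇
      obtain ⟨s₁, rfl⟩ := Option.ne_none_iff_exists'.1 h₆
      have hse' : s₀ ≠ e' := fun h => h₅ (h ▸ he')
      refine cons h₁ (fun _ => ⟨h₈, h₆⟩) hn ?_
      simpa [restOf, hse'] using ih s₁ (by simp [restOf, hse])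
  induction h₁ generalizing s with
  | nil => simp at hl
  | bot hs hne hr ih =>
    cases hl
    exact key hs hne hr (fun s h => ih h) (show _ = _ from rfl)
  | node hs hne hl₀ h₀ hr _ ih =>
    cases hl
    rw [List.append_assoc]
    exact key hs hne hr (fun s h => ih h) ⟨hl₀, _, h₀.mono hc, rfl⟩

end Denotes

/-! ### The state of the memory -/

/-- The lists of `σ` are well-formed, `list_q` denotes `L q`, and the ends of the lists belong to
`B` and are distinct. -/
structure State.Represents {V : Type v} {Q : Type w} (σ : State V Q) (B : Set ℕ)
    (L : Q → List (MarkerSeq V)) : Prop where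
  denotes : ∀ q, Denotes σ.cells B (σ.list q) (L q)
  fresh : ∀ a, σ.free ≤ a → σ.cells a = none
  lt_free : ∀ b ∈ B, b < σ.free
  end_mem : ∀ q s e, σ.list q = some (s, e) → e ∈ B
  end_inj : ∀ q q' s s' e, σ.list q = some (s, e) → σ.list q' = some (s', e) → q = q'

namespace State

variable {V : Type v} {Q : Type w} {σ : State V Q} {B : Set ℕ} {L : Q → List (MarkerSeq V)}

theorem Represents.congr (h : σ.Represents B L) {σ' : State V Q} (hc : σ'.cells = σ.cells)
    (hf : σ'.free = σ.free) (hl : σ'.list = σ.list) : σ'.Represents B L := by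
  obtain ⟨c, f, l, o, t⟩ := σ'
  simp only at hc hf hl
  subst hc hf hl
  exact ⟨h.1, h.2, h.3, h.4, h.5⟩

variable [DecidableEq Q]

/-- The new cell is at a fresh address, which no existing list meets. The second conclusion carries
saved lists through the operation. -/
theorem Represents.add (h : σ.Represents B L) (p : Q) {n : DagNode V}
    {Ms : List (MarkerSeq V)} (hn : n.Denotes σ.cells B Ms) :
    ∃ B', (σ.add p n).Represents B' (Function.update L p (Ms ++ L p)) ∧
      ∀ l Ms', Denotes σ.cells B l Ms' → Denotes (σ.add p n).cells B' l Ms' := by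
  have hfree : σ.cells σ.free = none := h.fresh _ le_rfl
  have hfB : σ.free ∉ B := fun hf => (h.lt_free _ hf).false
  -- The new cell is an end only if `list_p` was empty; otherwise its next pointer is used and must
  -- stay fixed.
  let B' : Set ℕ := if σ.list p = none then insert σ.free B else B
  have hB' : ∀ a, a ≠ σ.free → a ∉ B → a ∉ B' := by
    intro a ha haB
    simp only [B']
    split_ifs <;> simp [ha, haB]
  have hBB' : B ⊆ B' := by
    simp only [B']
    split_ifs <;> simp
  have hmono : ∀ l Ms', Denotes σ.cells B l Ms' → Denotes (σ.add p n).cells B' l Ms' := by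
    intro l Ms' hl
    refine hl.mono fun a c hac => ?_
    have ha : a ≠ σ.free := by rintro rfl; simp [hfree] at hac
    exact ⟨c, by simpa [State.add, ha] using hac, rfl, fun haB => ⟨rfl, hB' a ha haB⟩⟩
  have hn' : n.Denotes (σ.add p n).cells B' Ms := by
    cases n with
    | bot => exact hn
    | node S i l =>
      obtain ⟨hl, Ms₁, hMs₁, rfl⟩ := hn
      exact ⟨hl, Ms₁, hmono _ _ hMs₁, rfl⟩
  have hlp : (σ.add p n).list p = match σ.list p with
        | none => some (σ.free, σ.free)
        | some (_, e) => some (σ.free, e) := by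
    cases hp : σ.list p <;> simp [State.add, hp]
  have hlq : ∀ q, q ≠ p → (σ.add p n).list q = σ.list q := by
    intro q hq; simp [State.add, hq]
  have hcell : (σ.add p n).cells σ.free = some ⟨n, (σ.list p).map Prod.fst⟩ := by
    simp [State.add]
  have hend : ∀ q s e, (σ.add p n).list q = some (s, e) →
      (∃ s', σ.list q = some (s', e)) ∨ (q = p ∧ σ.list p = none ∧ e = σ.free) := by
    intro q s e hq
    by_cases hqp : q = p
    · subst hqp
      rw [hlp] at hq
      cases hL : σ.list q with
      | none => simp [hL] at hq; exact Or.inr ⟨rfl, rfl, hq.2.symm⟩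
      | some x => simp [hL] at hq; exact Or.inl ⟨x.1, by rw [← hq.2]⟩
    · rw [hlq q hqp] at hq
      exact Or.inl ⟨s, hq⟩
  refine ⟨B', ⟨?_, ?_, ?_, ?_, ?_⟩, hmono⟩
  · intro q
    by_cases hqp : q = p
    · subst hqp
      rw [Function.update_self, hlp]
      have hL := hmono _ _ (h.denotes q)
      cases hlist : σ.list q with
      | none =>
        rw [hlist] at hL hcell
        refine .cons hcell (by simp) hn' ?_
        simpa [restOf] using hL
      | some x =>
        obtain ⟨s, e⟩ := x
        rw [hlist] at hL hcell
        have he := h.end_mem _ _ _ hlist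
        have hne : σ.free ≠ e := fun hf => hfB (hf ▸ he)
        refine .cons hcell (fun _ => ⟨?_, by simp⟩) hn' ?_
        · simpa [B', hlist] using hfB
        · simpa [restOf, hne] using hL
    · rw [Function.update_of_ne hqp, hlq q hqp]
      exact hmono _ _ (h.denotes q)
  · intro a ha
    have ha' : σ.free + 1 ≤ a := ha
    have : a ≠ σ.free := by omega
    simpa [State.add, this] using h.fresh a (by omega)
  · intro b hb
    change b < σ.free + 1
    have : b = σ.free ∨ b ∈ B := by
      simp only [B'] at hb
      split_ifs at hb
      · simpa using hb
      · exact Or.inr hb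
    rcases this with rfl | hb
    · omega
    · have := h.lt_free b hb
      omega
  · intro q s e hq
    rcases hend q s e hq with ⟨s', h'⟩ | ⟨rfl, h₁, rfl⟩
    · exact hBB' (h.end_mem _ _ _ h')
    · simp [B', h₁]
  · intro q q' s s' e hq hq'
    rcases hend q s e hq with ⟨s₁, h₁⟩ | ⟨rfl, h₁, rfl⟩ <;>
    rcases hend q' s' _ hq' with ⟨s₂, h₂⟩ | ⟨rfl, h₂, h₃⟩
    · exact h.end_inj _ _ _ _ _ h₁ h₂
    · exact absurd (h.end_mem _ _ _ h₁) (h₃ ▸ hfB)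
    · exact absurd (h.end_mem _ _ _ h₂) hfB
    · rfl

/-- If `list_p` is nonempty, its old end leaves `B`; no other current list ends there, since ends
are distinct. The last conclusion protects the ends of saved lists that still wait to be appended.
-/
theorem Represents.append (h : σ.Represents B L) (p : Q) {s' e' : ℕ}
    {Ms : List (MarkerSeq V)} (hl : Denotes σ.cells B (some (s', e')) Ms) (he' : e' ∈ B)
    (hne : ∀ q s, σ.list q ≠ some (s, e')) :
    ∃ B', (σ.append p (some (s', e'))).Represents B' (Function.update L p (L p ++ Ms)) ∧
      (∀ l Ms', Denotes σ.cells B l Ms' →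
        Denotes (σ.append p (some (s', e'))).cells B' l Ms') ∧
      ∀ b ∈ B, (∀ q s, σ.list q ≠ some (s, b)) → b ∈ B' := by
  have hlq : ∀ q, q ≠ p → (σ.append p (some (s', e'))).list q = σ.list q := by
    intro q hq
    unfold State.append
    split <;> simp_all
  have hlp : (σ.append p (some (s', e'))).list p = match σ.list p with
        | none => some (s', e')
        | some (s, _) => some (s, e') := by
    unfold State.append
    split <;> simp_all
  have hend : ∀ q s e, (σ.append p (some (s', e'))).list q = some (s, e) →
      (q ≠ p ∧ σ.list q = some (s, e)) ∨ (q = p ∧ e = e') := by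
    intro q s e hq
    by_cases hqp : q = p
    · subst hqp
      rw [hlp] at hq
      cases hL : σ.list q with
      | none => simp [hL] at hq; exact Or.inr ⟨rfl, hq.2.symm⟩
      | some x => simp [hL] at hq; exact Or.inr ⟨rfl, hq.2.symm⟩
    · rw [hlq q hqp] at hq
      exact Or.inl ⟨hqp, hq⟩
  have hinj : ∀ q q' s₁ s₂ e, (σ.append p (some (s', e'))).list q = some (s₁, e) →
      (σ.append p (some (s', e'))).list q' = some (s₂, e) → q = q' := by
    intro q q' s₁ s₂ e hq hq'
    rcases hend q s₁ e hq with ⟨_, h₁⟩ | ⟨rfl, rfl⟩ <;>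
    rcases hend q' s₂ _ hq' with ⟨_, h₂⟩ | ⟨rfl, h₃⟩
    · exact h.end_inj _ _ _ _ _ h₁ h₂
    · exact absurd (h₃ ▸ h₁) (hne q s₁)
    · exact absurd h₂ (hne q' s₂)
    · rfl
  cases hp : σ.list p with
  | none =>
    have hc : (σ.append p (some (s', e'))).cells = σ.cells := by
      simp [State.append, hp]
    have hf : (σ.append p (some (s', e'))).free = σ.free := by
      simp [State.append, hp]
    refine ⟨B, ⟨?_, ?_, ?_, ?_, ?_⟩, ?_, fun b hb _ => hb⟩
    · intro q
      rw [hc]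
      by_cases hqp : q = p
      · subst hqp
        have := h.denotes q
        rw [hp] at this
        rw [Function.update_self, hlp, hp, this.eq_nil]
        exact hl
      · rw [Function.update_of_ne hqp, hlq q hqp]
        exact h.denotes q
    · rw [hf, hc]; exact h.fresh
    · rw [hf]; exact h.lt_free
    · intro q s e hq
      rcases hend q s e hq with ⟨_, h₁⟩ | ⟨_, rfl⟩
      · exact h.end_mem _ _ _ h₁
      · exact he'
    · exact hinj
    · rw [hc]; exact fun _ _ h => h
  | some x =>
    obtain ⟨s, e⟩ := x
    have hc : (σ.append p (some (s', e'))).cells = Function.update σ.cells e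
        ((σ.cells e).map fun c => { c with next := some s' }) := by
      simp [State.append, hp]
    have hf : (σ.append p (some (s', e'))).free = σ.free := by
      simp [State.append, hp]
    have heB := h.end_mem _ _ _ hp
    have hee' : e ≠ e' := fun h' => hne p s (h' ▸ hp)
    have hcells : ∀ a c, σ.cells a = some c →
        ∃ c', (σ.append p (some (s', e'))).cells a = some c' ∧ c'.payload = c.payload ∧
          (a ∉ B → c'.next = c.next ∧ a ∉ B \ {e}) := by
      intro a c hac
      by_cases hae : a = e
      · subst hae
        exact ⟨{ c with next := some s' }, by simp [hc, hac], rfl, fun h' => absurd heB h'⟩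
      · exact ⟨c, by simp [hc, hae, hac], rfl, fun h' => ⟨rfl, fun h'' => h' h''.1⟩⟩
    refine ⟨B \ {e}, ⟨?_, ?_, ?_, ?_, ?_⟩, fun l Ms' h' => h'.mono hcells, ?_⟩
    · intro q
      by_cases hqp : q = p
      · subst hqp
        rw [Function.update_self, hlp, hp]
        have := h.denotes q
        rw [hp] at this
        refine this.append he' hee' hcells (by simp) ?_ (hl.mono hcells)
        intro c hce
        rw [hc, Function.update_self] at hce
        obtain ⟨c₀, _, rfl⟩ := Option.map_eq_some_iff.1 hce
        rfl
      · rw [Function.update_of_ne hqp, hlq q hqp]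
        exact (h.denotes q).mono hcells
    · intro a ha
      rw [hf] at ha
      have h₀ := h.fresh a ha
      have hae : a ≠ e := by
        have := h.lt_free e heB
        omega
      simp [hc, hae, h₀]
    · rw [hf]; exact fun b hb => h.lt_free b hb.1
    · intro q s₁ e₁ hq
      rcases hend q s₁ e₁ hq with ⟨hqp, h₁⟩ | ⟨_, rfl⟩
      · refine ⟨h.end_mem _ _ _ h₁, ?_⟩
        rintro rfl
        exact hqp (h.end_inj _ _ _ _ _ h₁ hp)
      · exact ⟨he', hee'.symm⟩
    · exact hinj
    · intro b hb hb'
      refine ⟨hb, ?_⟩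
      rintro rfl
      exact hb' p s hp

end State

namespace State

variable {V : Type v} {Q : Type w} [DecidableEq Q]

theorem append_old (p : Q) (l : PList) (σ : State V Q) : (σ.append p l).old = σ.old := by
  unfold State.append
  split <;> rfl

theorem append_list_end {p q : Q} {l : PList} {σ : State V Q} {s e : ℕ}
    (h : (σ.append p l).list q = some (s, e)) :
    (∃ s', σ.list q = some (s', e)) ∨ ∃ s', l = some (s', e) := by
  by_cases hq : q = p
  · subst hq
    cases l with
    | none => exact Or.inl ⟨s, by simpa [State.append] using h⟩
    | some x =>
      refine Or.inr ⟨x.1, ?_⟩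
      cases hl : σ.list q with
      | none =>
        simp only [State.append, hl, Function.update_self, Option.some.injEq] at h
        rw [h]
      | some y =>
        simp only [State.append, hl, Function.update_self, Option.some.injEq,
          Prod.mk.injEq] at h
        rw [← h.2]
  · refine Or.inl ⟨s, ?_⟩
    unfold State.append at h
    split at h
    · exact h
    · simpa [hq] using h
    · simpa [hq] using h

end State

namespace EVA.Presentation

variable {α : Type u} {V : Type v} {Q : Type w} [DecidableEq α] [DecidableEq Q]
variable {A : EVA α V Q} (P : A.Presentation)

/-! ### The lists computed by Evaluate -/

theorem foldl_save (qs : List Q) (σ : State V Q) :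
    (qs.foldl (fun σ q => σ.save q) σ).cells = σ.cells ∧
    (qs.foldl (fun σ q => σ.save q) σ).free = σ.free ∧
    (qs.foldl (fun σ q => σ.save q) σ).list = σ.list ∧
    ∀ q, (qs.foldl (fun σ q => σ.save q) σ).old q = if q ∈ qs then σ.list q else σ.old q := by
  induction qs generalizing σ with
  | nil => simp
  | cons q₀ qs ih =>
    obtain ⟨h₁, h₂, h₃, h₄⟩ := ih (σ.save q₀)
    refine ⟨h₁, h₂, h₃, fun q => ?_⟩
    rw [List.foldl_cons, h₄]
    by_cases hq : q = q₀
    · subst hq; simp [State.save]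
    · simp [State.save, hq]

theorem foldl_save_clear (qs : List Q) (hqs : qs.Nodup) (σ : State V Q) :
    (qs.foldl (fun σ q => (σ.save q).clear q) σ).cells = σ.cells ∧
    (qs.foldl (fun σ q => (σ.save q).clear q) σ).free = σ.free ∧
    (∀ q, (qs.foldl (fun σ q => (σ.save q).clear q) σ).list q =
      if q ∈ qs then none else σ.list q) ∧
    ∀ q, (qs.foldl (fun σ q => (σ.save q).clear q) σ).old q =
      if q ∈ qs then σ.list q else σ.old q := by
  induction qs generalizing σ with
  | nil => simp
  | cons q₀ qs ih =>
    obtain ⟨hq₀, hqs⟩ := List.nodup_cons.1 hqs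
    obtain ⟨h₁, h₂, h₃, h₄⟩ := ih hqs ((σ.save q₀).clear q₀)
    refine ⟨h₁, h₂, fun q => ?_, fun q => ?_⟩
    · rw [List.foldl_cons, h₃]
      by_cases hq : q = q₀
      · subst hq; simp [State.save, State.clear]
      · simp [State.save, State.clear, hq]
    · rw [List.foldl_cons, h₄]
      by_cases hq : q = q₀
      · subst hq; simp [State.save, State.clear, hq₀]
      · simp [State.save, State.clear, hq]

omit [DecidableEq α] in
theorem initState_represents :
    ∃ B, P.initState.Represents B (fun q => if q = A.init then [[]] else []) := by
  let blank : State V Q :=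
    { cells := fun _ => none, free := 0, list := fun _ => none, old := fun _ => none, time := 0 }
  have key (qs : List Q) (σ : State V Q) (hσ : σ.Represents ∅ (fun _ => []))
      (hl : σ.list = fun _ => none) :
      (qs.foldl (fun σ q => if q = A.init then σ.tick 1 else σ.clear q) σ).Represents ∅
        (fun _ => []) := by
    induction qs generalizing σ with
    | nil => exact hσ
    | cons q qs ih =>
      have hl' : (if q = A.init then σ.tick 1 else σ.clear q).list = fun _ => none := by
        split_ifs
        · exact hl
        · simp [State.clear, hl]
      refine ih _ (hσ.congr ?_ ?_ (hl'.trans hl.symm)) hl'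
      · dsimp only; split_ifs <;> rfl
      · dsimp only; split_ifs <;> rfl
  have hblank : blank.Represents ∅ (fun _ => []) :=
    ⟨fun _ => .nil, fun _ _ => rfl, by simp, by simp [blank], by simp [blank]⟩
  obtain ⟨B', h, -⟩ := (key P.states blank hblank rfl).add A.init (n := .bot)
    (Ms := [[]]) rfl
  refine ⟨B', ?_⟩
  change (State.add A.init .bot (P.states.foldl _ blank)).Represents B' _
  convert h using 1
  funext q
  by_cases hq : q = A.init
  · subst hq; simp
  · simp [hq]

/-- Saved lists keep their denotations during the loop, so a node created late still points to what
was there before the capture; hence at most one capture per position. A permutation suffices, as the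
order of the outputs is irrelevant. -/
theorem foldl_add_represents {q : Q} {i : ℕ} {Lold : Q → List (MarkerSeq V)}
    (ts : List (Finset (Marker V) × Q)) (σ : State V Q) {B : Set ℕ}
    {L : Q → List (MarkerSeq V)} (h : σ.Represents B L)
    (hold : ∀ q, Denotes σ.cells B (σ.old q) (Lold q)) (hq : σ.old q ≠ none) :
    ∃ B' L', (ts.foldl (fun σ t => (σ.tick 2).add t.2 (.node t.1 i (σ.old q))) σ).Represents
        B' L' ∧
      (∀ q', Denotes
        (ts.foldl (fun σ t => (σ.tick 2).add t.2 (.node t.1 i (σ.old q))) σ).cells B'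
        ((ts.foldl (fun σ t => (σ.tick 2).add t.2 (.node t.1 i (σ.old q))) σ).old q')
        (Lold q')) ∧
      ∀ p, (L' p).Perm ((ts.flatMap fun t =>
        if t.2 = p then (Lold q).map (· ++ [(t.1, i)]) else []) ++ L p) := by
  induction ts generalizing σ B L with
  | nil => exact ⟨B, L, h, hold, fun p => by simp⟩
  | cons t ts ih =>
    have h₀ : (σ.tick 2).Represents B L := h.congr rfl rfl rfl
    obtain ⟨B₁, h₁, h₂⟩ := h₀.add t.2 (n := .node t.1 i (σ.old q))
      (Ms := (Lold q).map (· ++ [(t.1, i)])) ⟨hq, _, hold q, rfl⟩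
    obtain ⟨B', L', h₃, h₄, h₅⟩ := ih _ h₁ (fun q' => h₂ _ _ (hold q')) hq
    refine ⟨B', L', h₃, h₄, fun p => (h₅ p).trans ?_⟩
    by_cases hp : t.2 = p
    · subst hp
      simp only [Function.update_self, List.flatMap_cons, if_true]
      rw [← List.append_assoc]
      exact List.perm_append_comm.append_right _
    · simp [hp, Function.update_of_ne (Ne.symm hp)]

omit [DecidableEq α] in
theorem capturing_represents (i : ℕ) {σ : State V Q} {B : Set ℕ}
    {L : Q → List (MarkerSeq V)} (h : σ.Represents B L) :
    ∃ B' L', (P.capturing i σ).Represents B' L' ∧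
      ∀ p, (L' p).Perm ((P.states.flatMap fun q => (P.captureAdj q).flatMap fun t =>
        if t.2 = p then (L q).map (· ++ [(t.1, i)]) else []) ++ L p) := by
  have key (qs : List Q) (σ : State V Q) {B : Set ℕ} {L Lold : Q → List (MarkerSeq V)}
      (h : σ.Represents B L) (hold : ∀ q, Denotes σ.cells B (σ.old q) (Lold q)) :
      ∃ B' L', (qs.foldl (fun σ q =>
          if σ.old q = none then σ.tick 1
          else (P.captureAdj q).foldl
            (fun σ t => (σ.tick 2).add t.2 (.node t.1 i (σ.old q))) (σ.tick 1)) σ).Represents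
          B' L' ∧
        ∀ p, (L' p).Perm ((qs.flatMap fun q => (P.captureAdj q).flatMap fun t =>
          if t.2 = p then (Lold q).map (· ++ [(t.1, i)]) else []) ++ L p) := by
    induction qs generalizing σ B L with
    | nil => exact ⟨B, L, h, fun p => by simp⟩
    | cons q qs ih =>
      rw [List.foldl_cons]
      have h₀ : (σ.tick 1).Represents B L := h.congr rfl rfl rfl
      by_cases hq : σ.old q = none
      · rw [if_pos hq]
        obtain ⟨B', L', h₁, h₂⟩ := ih (σ.tick 1) h₀ hold
        refine ⟨B', L', h₁, fun p => (h₂ p).trans (.of_eq ?_)⟩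
        have := hold q
        rw [hq] at this
        simp [this.eq_nil]
      · rw [if_neg hq]
        obtain ⟨B₁, L₁, h₁, h₂, h₃⟩ := foldl_add_represents (i := i) (P.captureAdj q) _ h₀ hold hq
        obtain ⟨B', L', h₄, h₅⟩ := ih _ h₁ h₂
        refine ⟨B', L', h₄, fun p => (h₅ p).trans ?_⟩
        rw [List.flatMap_cons]
        refine ((h₃ p).append_left _).trans ?_
        rw [← List.append_assoc]
        exact List.perm_append_comm.append_right _
  obtain ⟨h₁, h₂, h₃, h₄⟩ := foldl_save P.states σ
  refine key P.states _ (h.congr h₁ h₂ h₃) fun q => ?_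
  rw [h₁, h₄, if_pos (P.mem_states q)]
  exact h.denotes q

/-- Each saved list goes to at most one state, since `P.next q a` has at most one value. The loop
invariant on the lists still waiting is that their ends lie in `B`, are pairwise distinct, and are
not ends of current lists, so that they are not redirected before their turn. -/
theorem reading_represents (a : α) {σ : State V Q} {B : Set ℕ}
    {L : Q → List (MarkerSeq V)} (h : σ.Represents B L) :
    ∃ B' L', (P.reading a σ).Represents B' L' ∧
      ∀ p, (L' p).Perm (P.states.flatMap fun q => if P.next q a = some p then L q else []) := by
  have key (qs : List Q) (hqs : qs.Nodup) (σ : State V Q) {B : Set ℕ}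
      {L Lold : Q → List (MarkerSeq V)} (h : σ.Represents B L)
      (hold : ∀ q ∈ qs, Denotes σ.cells B (σ.old q) (Lold q))
      (hB : ∀ q ∈ qs, ∀ s e, σ.old q = some (s, e) → e ∈ B)
      (hne : ∀ q ∈ qs, ∀ s e, σ.old q = some (s, e) → ∀ q' s', σ.list q' ≠ some (s', e))
      (hinj : ∀ q ∈ qs, ∀ q' ∈ qs, ∀ s s' e, σ.old q = some (s, e) → σ.old q' = some (s', e) →
        q = q') :
      ∃ B' L', (qs.foldl (fun σ q =>
          if σ.old q = none then σ.tick 1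
          else
            match P.next q a with
            | none => σ.tick (1 + (P.letterAdj q).length)
            | some p => (σ.tick (1 + (P.letterAdj q).length)).append p (σ.old q)) σ).Represents
          B' L' ∧
        ∀ p, (L' p).Perm ((qs.flatMap fun q => if P.next q a = some p then Lold q else []) ++
          L p) := by
    induction qs generalizing σ B L with
    | nil => exact ⟨B, L, h, fun p => by simp⟩
    | cons q qs ih =>
      obtain ⟨hq₀, hqs⟩ := List.nodup_cons.1 hqs
      simp only [List.mem_cons, forall_eq_or_imp] at hold hB hne
      have hinj' : ∀ q ∈ qs, ∀ q' ∈ qs, ∀ s s' e, σ.old q = some (s, e) →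
          σ.old q' = some (s', e) → q = q' := fun q hq q' hq' =>
        hinj q (List.mem_cons_of_mem _ hq) q' (List.mem_cons_of_mem _ hq')
      -- A state that contributes nothing: its saved list is empty or it has no transition for `a`.
      have skip (k : ℕ) (hk : ∀ p, (if P.next q a = some p then Lold q else []) = []) :=
        (ih hqs (σ.tick k) (h.congr rfl rfl rfl) hold.2 hB.2 hne.2 hinj').imp
          fun B' => Exists.imp fun L' => And.imp_right fun h₂ p => (h₂ p).trans
            (.of_eq (l₂ := ((q :: qs).flatMap fun q =>
              if P.next q a = some p then Lold q else []) ++ L p) (by simp [hk]))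
      rw [List.foldl_cons]
      by_cases hq : σ.old q = none
      · rw [if_pos hq]
        refine skip 1 fun p => ?_
        have := hold.1
        rw [hq] at this
        simp [this.eq_nil]
      · rw [if_neg hq]
        cases hn : P.next q a with
        | none => exact skip _ fun p => by simp [hn]
        | some p₀ =>
          obtain ⟨⟨s, e⟩, hse⟩ := Option.ne_none_iff_exists'.1 hq
          have hd := hold.1
          rw [hse] at hd
          have h₀ : (σ.tick (1 + (P.letterAdj q).length)).Represents B L := h.congr rfl rfl rfl
          obtain ⟨B₁, h₁, h₂, h₃⟩ := h₀.append p₀ hd (hB.1 _ _ hse) (hne.1 _ _ hse)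
          simp only [hse]
          generalize hσ₁ : (σ.tick (1 + (P.letterAdj q).length)).append p₀ (some (s, e)) = σ₁
            at h₁ h₂ h₃ ⊢
          have hold₁ : σ₁.old = σ.old := hσ₁ ▸ State.append_old _ _ _
          have hlist₁ : ∀ q' s' e', σ₁.list q' = some (s', e') →
              (∃ s'', σ.list q' = some (s'', e')) ∨ e' = e := by
            intro q' s' e' h'
            rw [← hσ₁] at h'
            exact (State.append_list_end h').imp id fun ⟨_, h''⟩ => by cases h''; rfl
          obtain ⟨B', L', h₄, h₅⟩ := ih hqs σ₁ h₁
            (fun q' hq' => hold₁ ▸ h₂ _ _ (hold.2 q' hq'))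
            (fun q' hq' s' e' hse' => by
              rw [hold₁] at hse'
              exact h₃ _ (hB.2 _ hq' _ _ hse') (hne.2 _ hq' _ _ hse'))
            (fun q' hq' s' e' hse' q'' s'' h' => by
              rw [hold₁] at hse'
              rcases hlist₁ _ _ _ h' with ⟨s₃, h₆⟩ | rfl
              · exact hne.2 _ hq' _ _ hse' _ _ h₆
              -- Here `q'` would share the end just brought in by `q`; distinctness gives `q = q'`,
              -- although `q` does not occur among the remaining states.
              · have := hinj q List.mem_cons_self q' (List.mem_cons_of_mem _ hq') _ _ _ hse hse'
                exact hq₀ (this ▸ hq'))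
            (by rw [hold₁]; exact hinj')
          refine ⟨B', L', h₄, fun p => (h₅ p).trans ?_⟩
          by_cases hp : p₀ = p
          · subst hp
            simp only [Function.update_self, List.flatMap_cons, hn, if_true]
            refine (List.perm_append_comm.append_left _).trans ?_
            rw [← List.append_assoc]
            exact List.perm_append_comm.append_right _
          · simp [hp, hn, Function.update_of_ne (Ne.symm hp)]
  obtain ⟨h₁, h₂, h₃, h₄⟩ := foldl_save_clear P.states P.states_nodup σ
  simp only [P.mem_states, if_true] at h₃ h₄
  obtain ⟨B', L', h₅, h₆⟩ := key P.states P.states_nodup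
    (P.states.foldl (fun σ q => (σ.save q).clear q) σ) (B := B) (L := fun _ => []) (Lold := L)
    ⟨fun q => by rw [h₃]; exact .nil, by rw [h₁, h₂]; exact h.fresh,
      by rw [h₂]; exact h.lt_free, by simp [h₃], by simp [h₃]⟩
    (fun q _ => by rw [h₁, h₄]; exact h.denotes q)
    (fun q _ => by rw [h₄]; exact h.end_mem q)
    (by simp [h₃])
    (fun q _ q' _ => by rw [h₄, h₄]; exact h.end_inj q q')
  exact ⟨B', L', h₅, fun p => (h₆ p).trans (.of_eq (by simp))⟩

end EVA.Presentation

/-! ### The enumeration -/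

section Enumeration

variable {V : Type v} {Q : Type w} {σ : State V Q}

/-- `move` is a function and is undefined on the halting configuration. -/
theorem Trace.unique {c : Config V Q} {t t' : List (Event V)} (h : Trace σ c t)
    (h' : Trace σ c t') : t = t' := by
  induction h generalizing t' with
  | halt =>
    cases h' with
    | halt => rfl
    | step hm _ => simp [move] at hm
  | step hm _ ih =>
    cases h' with
    | halt => simp [move] at hm
    | step hm' h' =>
      rw [hm] at hm'
      cases hm'
      rw [ih h']

/-- `PassesWithin t acc D acc'`: if `acc` steps have passed since the last output, then all
delays up to the last output of `t` are at most `D`, and at most `acc'` steps have passed since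
then. -/
def PassesWithin (t : List (Event V)) (acc D acc' : ℕ) : Prop :=
  ∃ ds : List ℕ, ∃ a ≤ acc', (∀ t', delays acc (t ++ t') = ds ++ delays a t') ∧ ∀ k ∈ ds, k ≤ D

theorem PassesWithin.append {t₁ t₂ : List (Event V)} {a b c D : ℕ}
    (h₁ : PassesWithin t₁ a D b) (h₂ : ∀ b' ≤ b, PassesWithin t₂ b' D c) :
    PassesWithin (t₁ ++ t₂) a D c := by
  obtain ⟨ds, b', hb, h₃, h₄⟩ := h₁
  obtain ⟨ds', c', hc, h₅, h₆⟩ := h₂ b' hb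
  refine ⟨ds ++ ds', c', hc, fun t' => ?_, ?_⟩
  · rw [List.append_assoc, h₃, h₅, List.append_assoc]
  · simpa [or_imp, forall_and] using ⟨h₄, h₆⟩

theorem PassesWithin.silent {k a b D : ℕ} (h : a + k ≤ b) :
    PassesWithin [((k, none) : Event V)] a D b :=
  ⟨[], a + k, h, fun _ => rfl, by simp⟩

theorem PassesWithin.output {k a b D : ℕ} {M : MarkerSeq V} (h : a + k ≤ D) :
    PassesWithin [((k, some M) : Event V)] a D b :=
  ⟨[a + k], 0, Nat.zero_le _, fun _ => rfl, by simpa using h⟩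

/-- Processing a list at recursion depth at most `N`, with outputs that are written in time at
most `W`. -/
theorem Denotes.exists_trace {B : Set ℕ} {l : PList} {Ms : List (MarkerSeq V)}
    (h : Denotes σ.cells B l Ms) (map : MarkerSeq V) :
    ∃ t : List (Event V),
      (∀ todo stack t', Trace σ ⟨todo, stack⟩ t' → Trace σ ⟨todo, ⟨l, map⟩ :: stack⟩ (t ++ t')) ∧
      outputs t = Ms.map (· ++ map) ∧
      ∀ N W : ℕ, map.length ≤ N →
        (∀ M ∈ Ms, (M ++ map).length ≤ N ∧ writeTime (M ++ map) ≤ W) →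
        ∀ acc ≤ N + 2 + map.length, (l = none → acc ≤ N - map.length) →
          PassesWithin t acc (2 * N + 3 + W) (N + 1 - map.length) := by
  -- Let `m = map.length`. At most `N + 2` steps have passed when a top-level list is entered (`N +
  -- 1` before the call, and the call), and one more for each level down: `N + 2 + m`. A list at its
  -- end is met with at most `N - m`, either right after an output or after a return from depth `m +
  -- 1`, so leaving it gives `N + 1 - m`. An output costs at most `(N + 2 + m) + 1 + W ≤ 2 * N + 3 +
  -- W`.
  induction h generalizing map with
  | nil =>
    refine ⟨[(1, none)], fun todo stack t' h => ?_, rfl, fun N W hN _ acc _ hacc => .silent ?_⟩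
    · exact .step (by simp [move]) h
    · have := hacc rfl
      omega
  | @bot s e nx Ms hs hne hr ih =>
    obtain ⟨t, h₁, h₂, h₃⟩ := ih map
    refine ⟨(1 + writeTime map, some map) :: t, fun todo stack t' h => ?_, ?_, ?_⟩
    · refine .step ?_ (h₁ todo stack t' h)
      simp [move, hs, restOf]
    · simpa [outputs] using h₂
    · intro N W hN hM acc hacc _
      simp only [List.mem_cons, forall_eq_or_imp] at hM
      refine .append (t₁ := [_]) (b := N - map.length) ?_
        (fun b hb => h₃ N W hN hM.2 b (by omega) fun _ => hb)
      refine .output ?_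
      have := hM.1.2
      simp only [List.nil_append] at this
      omega
  | @node s e nx S i l Ms₁ Ms₂ hs hne hl hd hr ih₁ ih₂ =>
    obtain ⟨t₁, h₁, h₂, h₃⟩ := ih₁ ((S, i) :: map)
    obtain ⟨t₂, h₄, h₅, h₆⟩ := ih₂ map
    refine ⟨(1, none) :: (t₁ ++ t₂), fun todo stack t' h => ?_, ?_, ?_⟩
    · rw [List.cons_append, List.append_assoc]
      refine .step ?_ (h₁ todo (⟨restOf s e nx, map⟩ :: stack) _ (h₄ todo stack t' h))
      simp [move, hs, restOf]
    · have : outputs ((1, none) :: (t₁ ++ t₂)) = outputs t₁ ++ outputs t₂ := by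
        simp [outputs]
      rw [this, h₂, h₅]
      simp
    · intro N W hN hM acc hacc _
      simp only [List.mem_append, or_imp, forall_and, List.mem_map] at hM
      have hM₁ : ∀ M ∈ Ms₁, (M ++ (S, i) :: map).length ≤ N ∧
          writeTime (M ++ (S, i) :: map) ≤ W := by
        intro M hM'
        have h₁ := hM.1.1 _ ⟨M, hM', rfl⟩
        have h₂ := hM.2.1 _ ⟨M, hM', rfl⟩
        simp only [List.append_assoc, List.singleton_append] at h₁ h₂
        exact ⟨h₁, h₂⟩
      -- The stored list is nonempty, so some output extends `(S, i) :: map`; this bounds the depth.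
      have hN' : ((S, i) :: map).length ≤ N := by
        obtain ⟨M, hM'⟩ := List.exists_mem_of_ne_nil _ (hd.ne_nil hl)
        have := (hM₁ M hM').1
        rw [List.length_append] at this
        omega
      have h₇ := h₃ N W hN' hM₁
      rw [List.length_cons] at hN' h₇
      refine .append (t₁ := [_]) (b := acc + 1) (.silent le_rfl) fun b hb => ?_
      refine .append (h₇ b (by omega) fun h => absurd h hl) fun b hb => ?_
      exact h₆ N W hN (fun M hM' => ⟨hM.1.2 M hM', hM.2.2 M hM'⟩) b (by omega) (by omega)

theorem enumAllOutputs_iff {B : Set ℕ} {l : PList} {Ms : List (MarkerSeq V)}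
    (h : Denotes σ.cells B l Ms) (M : MarkerSeq V) : EnumAllOutputs σ l M ↔ M ∈ Ms := by
  obtain ⟨t, h₁, h₂, -⟩ := h.exists_trace []
  have ht : Trace σ ⟨[], [⟨l, []⟩]⟩ t := by simpa using h₁ [] [] [] .halt
  constructor
  · rintro ⟨t', ht', hM⟩
    rw [ht'.unique ht, h₂] at hM
    simpa using hM
  · intro hM
    exact ⟨t, ht, by simpa [h₂] using hM⟩

theorem exists_enumerate_trace {B : Set ℕ} {L : Q → List (MarkerSeq V)}
    (h : σ.Represents B L) (qs : List Q) (hqs : ∀ q ∈ qs, σ.list q ≠ none) (N W : ℕ)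
    (hL : ∀ q ∈ qs, ∀ M ∈ L q, M.length ≤ N ∧ writeTime M ≤ W) :
    ∃ t : List (Event V), Trace σ ⟨qs, []⟩ t ∧ outputs t = qs.flatMap L ∧
      ∀ acc ≤ N + 1, PassesWithin t acc (2 * N + 3 + W) (N + 1) := by
  induction qs with
  | nil => exact ⟨[], .halt, rfl, fun acc hacc => ⟨[], acc, hacc, fun _ => rfl, by simp⟩⟩
  | cons q qs ih =>
    simp only [List.mem_cons, forall_eq_or_imp] at hqs hL
    obtain ⟨t₁, h₁, h₂, h₃⟩ := ih hqs.2 hL.2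
    obtain ⟨t₂, h₄, h₅, h₆⟩ := (h.denotes q).exists_trace []
    refine ⟨(1, none) :: (t₂ ++ t₁), .step rfl (h₄ _ _ _ h₁), ?_, fun acc hacc => ?_⟩
    · have : outputs ((1, none) :: (t₂ ++ t₁)) = outputs t₂ ++ outputs t₁ := by
        simp [outputs]
      rw [this, h₂, h₅]
      simp
    · refine .append (t₁ := [_]) (b := N + 2) (.silent (by omega)) fun b hb => ?_
      refine .append (h₆ N W (Nat.zero_le _) (by simpa using hL.1) b (by simpa using hb)
        fun h => absurd h hqs.1) fun b hb => ?_
      exact h₃ b (by simpa using hb)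

theorem PassesWithin.delays_le {t : List (Event V)} {a b D : ℕ} (h : PassesWithin t a D b)
    (hb : b ≤ D) : ∀ k ∈ delays a t, k ≤ D := by
  obtain ⟨ds, a', ha', h₁, h₂⟩ := h
  intro k hk
  have := h₁ []
  rw [List.append_nil] at this
  rw [this] at hk
  simp only [delays, List.mem_append, List.mem_singleton] at hk
  rcases hk with hk | rfl
  · exact h₂ k hk
  · omega

end Enumeration

/-! ### The running time of Evaluate -/

theorem foldl_time_le {V : Type v} {Q : Type w} {β : Type*} (f : State V Q → β → State V Q)
    (g : β → ℕ) (hf : ∀ σ b, (f σ b).time ≤ σ.time + g b) (bs : List β) (σ : State V Q) :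
    (bs.foldl f σ).time ≤ σ.time + (bs.map g).sum := by
  induction bs generalizing σ with
  | nil => simp
  | cons b bs ih =>
    have h₁ := ih (f σ b)
    have h₂ := hf σ b
    simp only [List.foldl_cons, List.map_cons, List.sum_cons]
    omega

theorem State.time_append {V : Type v} {Q : Type w} [DecidableEq Q] (p : Q) (l : PList)
    (σ : State V Q) : (σ.append p l).time = σ.time + 1 := by
  unfold State.append
  split <;> rfl

/-- Tagged with their source states, the adjacency lists are disjoint parts of the set of
transitions. -/
theorem sum_length_le_card {Q : Type w} {β : Type*} (qs : List Q) (hqs : qs.Nodup)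
    (adj : Q → List β) (hadj : ∀ q, (adj q).Nodup) (s : Finset (Q × β))
    (hs : ∀ q, ∀ b ∈ adj q, (q, b) ∈ s) : (qs.map fun q => (adj q).length).sum ≤ s.card := by
  classical
  have hnd : (qs.flatMap fun q => (adj q).map (Prod.mk q)).Nodup := by
    refine List.nodup_flatMap.2 ⟨fun q _ => (hadj q).map (Prod.mk_right_injective q),
      hqs.imp fun {q q'} hne => ?_⟩
    simp only [Function.onFun, List.disjoint_left, List.mem_map]
    rintro _ ⟨b, _, rfl⟩ ⟨b', _, h⟩
    exact hne (congrArg Prod.fst h).symm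
  have hlen : (qs.flatMap fun q => (adj q).map (Prod.mk q)).length =
      (qs.map fun q => (adj q).length).sum := by simp [List.length_flatMap]
  rw [← hlen, ← List.toFinset_card_of_nodup hnd]
  refine Finset.card_le_card fun x hx => ?_
  simp only [List.mem_toFinset, List.mem_flatMap, List.mem_map] at hx
  obtain ⟨q, _, b, hb, rfl⟩ := hx
  exact hs q b hb

namespace EVA.Presentation

variable {α : Type u} {V : Type v} {Q : Type w} [DecidableEq α] [DecidableEq Q] [Fintype Q]
variable {A : EVA α V Q} (P : A.Presentation)

omit [DecidableEq α] in
theorem length_states : P.states.length = Fintype.card Q := by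
  rw [← List.toFinset_card_of_nodup P.states_nodup, ← Finset.card_univ]
  congr 1
  ext q
  simp [P.mem_states q]

omit [DecidableEq α] [DecidableEq Q] in
theorem length_finals_le : P.finals.length ≤ Fintype.card Q := P.finals_nodup.length_le_card

omit [DecidableEq α] [DecidableEq Q] [Fintype Q] in
theorem sum_captureAdj_le : (P.states.map fun q => (P.captureAdj q).length).sum ≤ A.capture.card :=
  sum_length_le_card _ P.states_nodup _ P.captureAdj_nodup _
    fun q b hb => (P.mem_captureAdj q b.1 b.2).1 hb

omit [DecidableEq α] [DecidableEq Q] [Fintype Q] in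
theorem sum_letterAdj_le : (P.states.map fun q => (P.letterAdj q).length).sum ≤ A.letter.card :=
  sum_length_le_card _ P.states_nodup _ P.letterAdj_nodup _
    fun q b hb => (P.mem_letterAdj q b.1 b.2).1 hb

omit [DecidableEq α] in
theorem time_initState_le : P.initState.time ≤ 2 * A.size := by
  have h := foldl_time_le (V := V) (fun σ q => if q = A.init then σ.tick 1 else σ.clear q)
    (fun _ => 1) (fun σ q => by split_ifs <;> exact le_rfl) P.states
    { cells := fun _ => none, free := 0, list := fun _ => none, old := fun _ => none, time := 0 }
  have hc : 0 < Fintype.card Q := Fintype.card_pos_iff.2 ⟨A.init⟩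
  simp only [List.map_const', List.sum_replicate, length_states] at h
  rw [EVA.size]
  refine (Nat.add_le_add_right h 1).trans ?_
  simp
  omega

omit [DecidableEq α] in
theorem time_capturing_le (i : ℕ) (σ : State V Q) :
    (P.capturing i σ).time ≤ σ.time + 3 * A.size := by
  have h₁ := foldl_time_le (V := V) (fun σ (q : Q) => σ.save q) (fun _ => 1)
    (fun σ q => le_rfl) P.states σ
  have h₂ := foldl_time_le (V := V) (fun σ q =>
      if σ.old q = none then σ.tick 1
      else (P.captureAdj q).foldl
        (fun σ t => (σ.tick 2).add t.2 (.node t.1 i (σ.old q))) (σ.tick 1))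
    (fun q => 1 + 3 * (P.captureAdj q).length) (fun σ q => by
      split_ifs
      · exact Nat.add_le_add_left (by omega) _
      · refine (foldl_time_le _ (fun _ => 3) (fun σ t => le_rfl) _ _).trans ?_
        simp [State.tick]
        omega) P.states (P.states.foldl (fun σ q => σ.save q) σ)
  have h₃ := P.sum_captureAdj_le
  simp only [List.map_const', List.sum_replicate, length_states] at h₁
  simp only [List.sum_map_add, List.sum_map_mul_left, List.map_const', List.sum_replicate,
    length_states] at h₂
  unfold EVA.size
  refine h₂.trans ?_
  simp only [smul_eq_mul] at h₁ ⊢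
  omega

theorem time_reading_le (a : α) (σ : State V Q) :
    (P.reading a σ).time ≤ σ.time + 4 * A.size := by
  have h₁ := foldl_time_le (V := V) (fun σ (q : Q) => (σ.save q).clear q) (fun _ => 2)
    (fun σ q => le_rfl) P.states σ
  have h₂ := foldl_time_le (V := V) (fun σ q =>
      if σ.old q = none then σ.tick 1
      else
        match P.next q a with
        | none => σ.tick (1 + (P.letterAdj q).length)
        | some p => (σ.tick (1 + (P.letterAdj q).length)).append p (σ.old q))
    (fun q => 2 + (P.letterAdj q).length) (fun σ q => by
      split_ifs
      · exact Nat.add_le_add_left (by omega) _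
      · split
        · exact Nat.add_le_add_left (by omega) _
        · rw [State.time_append]
          simp only [State.tick]
          omega) P.states (P.states.foldl (fun σ q => (σ.save q).clear q) σ)
  have h₃ := P.sum_letterAdj_le
  simp only [List.map_const', List.sum_replicate, length_states] at h₁
  simp only [List.sum_map_add, List.map_const', List.sum_replicate, length_states] at h₂
  unfold EVA.size
  refine h₂.trans ?_
  simp only [smul_eq_mul] at h₁ ⊢
  omega

/-- A round costs 3 for Capturing, 4 for Reading and 1 for the loop, in units of `A.size`, which is
positive. -/
theorem time_rounds_le (d : List α) (i : ℕ) :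
    (P.rounds d i).time ≤ 2 * A.size + i * (8 * A.size) := by
  induction i with
  | zero => simpa [rounds] using P.time_initState_le
  | succ i ih =>
    have hc : 0 < A.size := Nat.add_pos_left (Fintype.card_pos_iff.2 ⟨A.init⟩) _
    rw [add_mul, one_mul]
    unfold rounds
    split
    · omega
    · have h₁ := P.time_capturing_le (i + 1) (P.rounds d i)
      rename_i a _
      have h₂ := P.time_reading_le a (P.capturing (i + 1) (P.rounds d i))
      simp only [State.tick]
      omega

theorem time_evaluate_le (d : List α) :
    (P.evaluate d).1.time ≤ 8 * A.size * (d.length + 1) := by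
  have h₁ := P.time_rounds_le d d.length
  have h₂ := P.time_capturing_le (d.length + 1) (P.rounds d d.length)
  have h₃ : P.finals.length ≤ A.size := P.length_finals_le.trans (Nat.le_add_right _ _)
  simp only [evaluate, afterCapturing, State.tick]
  rw [show 8 * A.size * (d.length + 1) = d.length * (8 * A.size) + 8 * A.size by ring]
  omega

end EVA.Presentation

namespace EVA

variable {α : Type u} {V : Type v} {Q : Type w}

/-! ### Runs, by recursion on their length -/

/-- The pairs of a state and an output that result from those in `R` by a capture with position
`i`, or by staying. -/
def CaptureStep (A : EVA α V Q) (i : ℕ) (R : Q → MarkerSeq V → Prop) (p : Q)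
    (M : MarkerSeq V) : Prop :=
  R p M ∨ ∃ q S N, R q N ∧ (q, S, p) ∈ A.capture ∧ M = N ++ [(S, i)]

/-- The pairs `(qᵢ, Out)` of the prefixes of runs over `d` that end with reading the `i`-th
letter. -/
def Reach (A : EVA α V Q) (d : List α) : ℕ → Q → MarkerSeq V → Prop
  | 0, q, M => q = A.init ∧ M = []
  | i + 1, q, M => ∃ a p, d[i]? = some a ∧ A.CaptureStep (i + 1) (A.Reach d i) p M ∧
      (p, a, q) ∈ A.letter

variable {A : EVA α V Q} {d : List α}

theorem CaptureStep.pos_le {i : ℕ} {R : Q → MarkerSeq V → Prop}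
    (hR : ∀ q M, R q M → ∀ t ∈ M, t.2 ≤ i) {p : Q} {M : MarkerSeq V}
    (h : A.CaptureStep (i + 1) R p M) : ∀ t ∈ M, t.2 ≤ i + 1 := by
  rcases h with h | ⟨q, S, N, h, _, rfl⟩
  · exact fun t ht => (hR _ _ h t ht).trans (Nat.le_succ i)
  · intro t ht
    rw [List.mem_append, List.mem_singleton] at ht
    rcases ht with ht | rfl
    · exact (hR _ _ h t ht).trans (Nat.le_succ i)
    · exact le_rfl

theorem Reach.pos_le {i : ℕ} {p : Q} {M : MarkerSeq V} (h : A.Reach d i p M) :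
    ∀ t ∈ M, t.2 ≤ i := by
  induction i generalizing p M with
  | zero => simp [h.2]
  | succ i ih =>
    obtain ⟨a, q, _, h, _⟩ := h
    exact h.pos_le fun q M h => ih h

/-- Earlier positions are at most `i`, so a last pair at position `i + 1` betrays a capture made
just now. -/
theorem not_reach_append {i : ℕ} {p : Q} {N : MarkerSeq V} {S : Finset (Marker V)}
    (h : A.Reach d i p (N ++ [(S, i + 1)])) : False := by
  have := h.pos_le (S, i + 1) (by simp)
  simp at this

/-- The position in the last pair separates staying from capturing. For a capture, the remaining
output fixes the source state, and then the marker set fixes the target. -/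
theorem CaptureStep.state_unique (hA : A.Deterministic) {i : ℕ}
    (hR : ∀ q q' M, A.Reach d i q M → A.Reach d i q' M → q = q') {p p' : Q} {M : MarkerSeq V}
    (h : A.CaptureStep (i + 1) (A.Reach d i) p M)
    (h' : A.CaptureStep (i + 1) (A.Reach d i) p' M) : p = p' := by
  rcases h with h | ⟨q, S, N, h, hq, rfl⟩
  · rcases h' with h' | ⟨q', S', N', h', hq', rfl⟩
    · exact hR _ _ _ h h'
    · exact (not_reach_append h).elim
  · rcases h' with h' | ⟨q', S', N', h', hq', h''⟩
    · exact (not_reach_append h').elim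
    · simp only [List.append_singleton_inj, Prod.mk.injEq, and_true] at h''
      obtain ⟨rfl, rfl⟩ := h''
      obtain rfl := hR _ _ _ h h'
      exact hA.2 _ _ _ _ hq hq'

theorem Reach.state_unique (hA : A.Deterministic) {i : ℕ} {q q' : Q} {M : MarkerSeq V}
    (h : A.Reach d i q M) (h' : A.Reach d i q' M) : q = q' := by
  induction i generalizing q q' M with
  | zero => rw [h.1, h'.1]
  | succ i ih =>
    obtain ⟨a, p, ha, h, hq⟩ := h
    obtain ⟨a', p', ha', h', hq'⟩ := h'
    obtain rfl : a = a' := Option.some.inj (ha.symm.trans ha')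
    obtain rfl := h.state_unique hA (fun _ _ _ => ih) h'
    exact hA.1 _ _ _ _ hq hq'

/-- The output of the first `k` captures. -/
def outOf (S : ℕ → Finset (Marker V)) (k : ℕ) : MarkerSeq V :=
  ((List.range k).map (fun j => (S (j + 1), j + 1))).filter (fun t => decide t.1.Nonempty)

theorem outOf_succ (S : ℕ → Finset (Marker V)) (k : ℕ) :
    outOf S (k + 1) = outOf S k ++ if (S (k + 1)).Nonempty then [(S (k + 1), k + 1)] else [] := by
  unfold outOf
  rw [List.range_succ, List.map_append, List.filter_append]
  congr 1
  split_ifs with h <;> simp [h]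

theorem outOf_congr {S S' : ℕ → Finset (Marker V)} {k : ℕ}
    (h : ∀ j < k, S (j + 1) = S' (j + 1)) : outOf S k = outOf S' k := by
  unfold outOf
  congr 1
  refine List.map_congr_left fun j hj => ?_
  rw [h j (List.mem_range.1 hj)]

theorem captureStep_outOf {i : ℕ} {R : Q → MarkerSeq V → Prop} {q p : Q}
    {S : ℕ → Finset (Marker V)} (hR : R q (outOf S i)) (hstay : S (i + 1) = ∅ → q = p)
    (hcapture : S (i + 1) ≠ ∅ → (q, S (i + 1), p) ∈ A.capture) :
    A.CaptureStep (i + 1) R p (outOf S (i + 1)) := by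
  rw [outOf_succ]
  split_ifs with h
  · exact Or.inr ⟨q, _, _, hR, hcapture h.ne_empty, rfl⟩
  · rw [List.append_nil, ← hstay (Finset.not_nonempty_iff_eq_empty.1 h)]
    exact Or.inl hR

theorem Run.reach {i : ℕ} (hi : i ≤ d.length) (ρ : A.Run (d.take i)) {k : ℕ} (hk : k ≤ i) :
    A.Reach d k (ρ.q k) (outOf ρ.S k) := by
  have hlen : (d.take i).length = i := by simpa using hi
  induction k with
  | zero => exact ⟨ρ.start, rfl⟩
  | succ k ih =>
    refine ⟨d[k], ρ.p k, List.getElem?_eq_getElem _, captureStep_outOf (ih (by omega)) (ρ.stay k (by omega))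
      (ρ.capture k (by omega)), ?_⟩
    have := ρ.letter k (by omega)
    rwa [List.getElem_take] at this

/-- The first `i` captures and letters of a run over `d`. -/
structure IsPath (A : EVA α V Q) (d : List α) (i : ℕ) (q p : ℕ → Q)
    (S : ℕ → Finset (Marker V)) : Prop where
  start : q 0 = A.init
  stay : ∀ k < i, S (k + 1) = ∅ → q k = p k
  capture : ∀ k < i, S (k + 1) ≠ ∅ → (q k, S (k + 1), p k) ∈ A.capture
  letter : ∀ k < i, ∃ a, d[k]? = some a ∧ (p k, a, q (k + 1)) ∈ A.letter

theorem CaptureStep.exists_path {i : ℕ} {p₀ : Q}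
    {M : MarkerSeq V}
    (hR : ∀ q₀ M, A.Reach d i q₀ M → ∃ q p S, A.IsPath d i q p S ∧ q i = q₀ ∧ outOf S i = M)
    (h : A.CaptureStep (i + 1) (A.Reach d i) p₀ M) :
    ∃ q p S, A.IsPath d i q p S ∧ p i = p₀ ∧ outOf S (i + 1) = M ∧
      (S (i + 1) = ∅ → q i = p i) ∧ (S (i + 1) ≠ ∅ → (q i, S (i + 1), p i) ∈ A.capture) := by
  -- Staying is the case `S₀ = ∅`. Only `p i` and `S (i + 1)` are changed, which `IsPath` up to `i`
  -- does not constrain.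
  have key (q p : ℕ → Q) (S : ℕ → Finset (Marker V)) (S₀ : Finset (Marker V))
      (h : A.IsPath d i q p S) (h₁ : S₀ = ∅ → q i = p₀)
      (h₂ : S₀ ≠ ∅ → (q i, S₀, p₀) ∈ A.capture)
      (hM : M = outOf S i ++ if S₀.Nonempty then [(S₀, i + 1)] else []) :
      ∃ q p S, A.IsPath d i q p S ∧ p i = p₀ ∧ outOf S (i + 1) = M ∧
      (S (i + 1) = ∅ → q i = p i) ∧ (S (i + 1) ≠ ∅ → (q i, S (i + 1), p i) ∈ A.capture) := by
    have hS : ∀ k < i, Function.update S (i + 1) S₀ (k + 1) = S (k + 1) := fun k hk =>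
      Function.update_of_ne (by omega) _ _
    have hp : ∀ k < i, Function.update p i p₀ k = p k := fun k hk =>
      Function.update_of_ne (by omega) _ _
    refine ⟨q, Function.update p i p₀, Function.update S (i + 1) S₀,
      ⟨h.start, fun k hk => ?_, fun k hk => ?_, fun k hk => ?_⟩, by simp, ?_,
      by simpa using h₁, by simpa using h₂⟩
    · rw [hS k hk, hp k hk]; exact h.stay k hk
    · rw [hS k hk, hp k hk]; exact h.capture k hk
    · rw [hp k hk]; exact h.letter k hk
    · rw [outOf_succ, Function.update_self, outOf_congr hS, hM]
  rcases h with h | ⟨q₀, S₀, N, h, hq, rfl⟩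
  · obtain ⟨q, p, S, h₁, h₂, h₃⟩ := hR _ _ h
    exact key q p S ∅ h₁ (fun _ => h₂) (fun h => absurd rfl h) (by simp [h₃])
  · obtain ⟨q, p, S, h₁, h₂, h₃⟩ := hR _ _ h
    have hS₀ : S₀.Nonempty := A.capture_nonempty _ hq
    exact key q p S S₀ h₁ (fun h => absurd h hS₀.ne_empty) (fun _ => h₂ ▸ hq) (by simp [h₃, hS₀])

theorem Reach.exists_path {i : ℕ} {q₀ : Q} {M : MarkerSeq V} (h : A.Reach d i q₀ M) :
    ∃ q p S, A.IsPath d i q p S ∧ q i = q₀ ∧ outOf S i = M := by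
  induction i generalizing q₀ M with
  | zero =>
    exact ⟨fun _ => q₀, fun _ => q₀, fun _ => ∅, ⟨h.1, by simp, by simp, by simp⟩, rfl, h.2.symm⟩
  | succ i ih =>
    obtain ⟨a, p₀, ha, h, hq⟩ := h
    obtain ⟨q, p, S, h₁, h₂, h₃, h₄, h₅⟩ := h.exists_path (fun _ _ => ih)
    have hq' : ∀ k ≤ i, Function.update q (i + 1) q₀ k = q k := fun k hk =>
      Function.update_of_ne (by omega) _ _
    refine ⟨Function.update q (i + 1) q₀, p, S, ⟨?_, fun k hk => ?_, fun k hk => ?_,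
      fun k hk => ?_⟩, by simp, h₃⟩
    · rw [hq' 0 (Nat.zero_le i)]; exact h₁.start
    · rw [hq' k (by omega)]
      rcases Nat.lt_succ_iff_lt_or_eq.1 hk with hk | rfl
      · exact h₁.stay k hk
      · exact h₄
    · rw [hq' k (by omega)]
      rcases Nat.lt_succ_iff_lt_or_eq.1 hk with hk | rfl
      · exact h₁.capture k hk
      · exact h₅
    · rcases Nat.lt_succ_iff_lt_or_eq.1 hk with hk | rfl
      · rw [hq' (k + 1) (by omega)]; exact h₁.letter k hk
      · exact ⟨a, ha, by simpa [h₂] using hq⟩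

theorem exists_run_iff {i : ℕ} (hi : i ≤ d.length) (p : Q) (M : MarkerSeq V) :
    (∃ ρ : A.Run (d.take i), ρ.last = p ∧ ρ.out = M) ↔
      A.CaptureStep (i + 1) (A.Reach d i) p M := by
  have hlen : (d.take i).length = i := by simpa using hi
  constructor
  · rintro ⟨ρ, rfl, rfl⟩
    have := captureStep_outOf (ρ.reach hi le_rfl) (ρ.stay i hlen.ge) (ρ.capture i hlen.ge)
    simpa only [hlen, Run.last, Run.out, outOf] using this
  · intro h
    obtain ⟨q, p, S, h₁, h₂, h₃, h₄, h₅⟩ :=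
      h.exists_path fun _ _ => Reach.exists_path
    refine ⟨⟨q, p, S, h₁.start, fun k hk => ?_, fun k hk => ?_, fun k hk => ?_⟩, ?_, ?_⟩
    · rw [hlen] at hk
      rcases hk.lt_or_eq with hk | rfl
      · exact h₁.stay k hk
      · exact h₄
    · rw [hlen] at hk
      rcases hk.lt_or_eq with hk | rfl
      · exact h₁.capture k hk
      · exact h₅
    · obtain ⟨a, ha, hl⟩ := h₁.letter k (hlen ▸ hk)
      have hk' : k < d.length := by omega
      rw [List.getElem?_eq_getElem hk'] at ha
      rw [List.getElem_take, Option.some.inj ha]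
      exact hl
    · simpa only [Run.last, hlen] using h₂
    · simpa only [Run.out, hlen, outOf] using h₃

/-! ### The mapping of a valid run -/

section Mapping

variable [DecidableEq V] {ρ ρ' : A.Run d}

omit [DecidableEq V] in
theorem Run.mem_out {t : Finset (Marker V) × ℕ} :
    t ∈ ρ.out ↔ t.2 ∈ Set.Icc 1 (d.length + 1) ∧ t.1 = ρ.S t.2 ∧ t.1.Nonempty := by
  simp only [Run.out, List.mem_filter, List.mem_map, List.mem_range, decide_eq_true_eq,
    ← and_assoc]
  refine and_congr_left fun _ => ⟨?_, ?_⟩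
  · rintro ⟨k, hk, rfl⟩
    exact ⟨⟨by omega, by dsimp only; omega⟩, rfl⟩
  · rintro ⟨⟨h₁, h₂⟩, h₃⟩
    have : t.2 - 1 + 1 = t.2 := by omega
    exact ⟨t.2 - 1, by omega, by rw [this, ← h₃]⟩

/-- By disjointness a marker occurs in only one of the sets, so the first occurrence found is the
only one. -/
theorem Run.Valid.posOf_eq_some_iff (h : ρ.Valid) (m : Marker V) (j : ℕ) :
    MarkerSeq.posOf m ρ.out = some j ↔ j ∈ Set.Icc 1 (d.length + 1) ∧ m ∈ ρ.S j := by
  have hfind : ∀ t, ρ.out.find? (fun t => decide (m ∈ t.1)) = some t →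
      t.2 ∈ Set.Icc 1 (d.length + 1) ∧ m ∈ ρ.S t.2 := by
    intro t ht
    obtain ⟨h₁, h₂, _⟩ := Run.mem_out.1 (List.mem_of_find?_eq_some ht)
    refine ⟨h₁, h₂ ▸ ?_⟩
    simpa using List.find?_some ht
  constructor
  · intro hj
    obtain ⟨t, ht, rfl⟩ := Option.map_eq_some_iff.1 hj
    exact hfind t ht
  · rintro ⟨hj, hm⟩
    have hsome : (ρ.out.find? (fun t => decide (m ∈ t.1))).isSome := by
      rw [List.find?_isSome]
      exact ⟨(ρ.S j, j), Run.mem_out.2 ⟨hj, rfl, ⟨m, hm⟩⟩, by simpa using hm⟩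
    obtain ⟨t, ht⟩ := Option.isSome_iff_exists.1 hsome
    obtain ⟨h₁, h₂⟩ := hfind t ht
    refine Option.map_eq_some_iff.2 ⟨t, ht, ?_⟩
    by_contra hne
    exact Finset.disjoint_left.1 (h.1 _ h₁ _ hj hne) h₂ hm

theorem Run.Valid.defines (h : ρ.Valid) : ρ.Defines (MarkerSeq.toMapping ρ.out) := by
  intro x s
  change MarkerSeq.spanOf ρ.out x = some s ↔ _
  have hl := s.one_le
  have hh := s.le
  have h₁ : MarkerSeq.spanOf ρ.out x = some s ↔
      MarkerSeq.posOf (.opn x) ρ.out = some s.lo ∧ MarkerSeq.posOf (.cls x) ρ.out = some s.hi := by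
    unfold MarkerSeq.spanOf
    constructor
    · intro hs
      split at hs
      · split_ifs at hs
        cases hs
        exact ⟨by assumption, by assumption⟩
      · cases hs
    · rintro ⟨h₁, h₂⟩
      rw [h₁, h₂]
      simp [hl, hh]
  rw [h₁, h.posOf_eq_some_iff, h.posOf_eq_some_iff]
  constructor
  · rintro ⟨⟨_, h₂⟩, h₃, h₄⟩
    exact ⟨h₃.2, h₂, h₄⟩
  · rintro ⟨h₂, h₃, h₄⟩
    exact ⟨⟨⟨hl, hh.trans h₂⟩, h₃⟩, ⟨hl.trans hh, h₂⟩, h₄⟩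

omit [DecidableEq V] in
theorem Run.Defines.unique {μ μ' : SMapping V} (h : ρ.Defines μ) (h' : ρ.Defines μ') :
    μ = μ' := by
  ext x s
  exact (h x s).trans (h' x s).symm

-- Validity of `ρ` supplies the partner of each marker, so the common mapping records the marker
-- with its position, and `ρ'` must have it in the same place.
omit [DecidableEq V] in
theorem Run.Valid.subset {μ : SMapping V} (h : ρ.Valid) (hμ : ρ.Defines μ)
    (hμ' : ρ'.Defines μ) {j : ℕ} (hj : j ∈ Set.Icc 1 (d.length + 1)) : ρ.S j ⊆ ρ'.S j := by
  intro m hm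
  cases m with
  | opn x =>
    obtain ⟨k, hk, hjk, hx⟩ := h.2.1 x j hj hm
    exact ((hμ' x ⟨j, k, hj.1, hjk⟩).1 ((hμ x ⟨j, k, hj.1, hjk⟩).2 ⟨hk.2, hm, hx⟩)).2.1
  | cls x =>
    obtain ⟨k, hk, hjk, hx⟩ := h.2.2 x j hj hm
    exact ((hμ' x ⟨k, j, hk.1, hjk⟩).1 ((hμ x ⟨k, j, hk.1, hjk⟩).2 ⟨hj.2, hx, hm⟩)).2.2

theorem Run.Valid.out_eq (h : ρ.Valid) (h' : ρ'.Valid)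
    (hout : MarkerSeq.toMapping ρ.out = MarkerSeq.toMapping ρ'.out) : ρ.out = ρ'.out := by
  have hμ := h.defines
  have hμ' := h'.defines
  rw [← hout] at hμ'
  refine outOf_congr fun j hj => ?_
  have hj : j + 1 ∈ Set.Icc 1 (d.length + 1) := ⟨by omega, by omega⟩
  exact (h.subset hμ hμ' hj).antisymm (h'.subset hμ' hμ hj)

/-- A valid run uses each marker at most once, and each variable has two markers. -/
theorem Run.Valid.sum_card_out_le (h : ρ.Valid) :
    (ρ.out.map fun t => t.1.card).sum ≤ 2 * A.vars.card := by
  have h₁ : (ρ.out.map fun t => t.1.card).sum ≤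
      ∑ k ∈ Finset.range (d.length + 1), (ρ.S (k + 1)).card := by
    have : (((List.range (d.length + 1)).map fun k => (ρ.S (k + 1), k + 1)).map
        fun t => t.1.card).sum = ∑ k ∈ Finset.range (d.length + 1), (ρ.S (k + 1)).card := by
      rw [List.map_map]; rfl
    rw [← this]
    exact (List.filter_sublist.map _).sum_le_sum (by simp)
  have h₂ : ∀ k ∈ Finset.range (d.length + 1), k + 1 ∈ Set.Icc 1 (d.length + 1) := by
    intro k hk
    rw [Finset.mem_range] at hk
    exact ⟨by omega, by omega⟩
  rw [← Finset.card_biUnion fun k hk k' hk' hne =>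
    h.1 _ (h₂ k hk) _ (h₂ k' hk') (by omega)] at h₁
  refine h₁.trans ?_
  have h₃ : (Finset.range (d.length + 1)).biUnion (fun k => ρ.S (k + 1)) ⊆
      A.vars.image Marker.opn ∪ A.vars.image Marker.cls := by
    intro m hm
    obtain ⟨k, hk, hm⟩ := Finset.mem_biUnion.1 hm
    rw [Finset.mem_range] at hk
    have hvar : m.var ∈ A.vars := Finset.mem_biUnion.2
      ⟨_, ρ.capture k (by omega) (Finset.ne_empty_of_mem hm), Finset.mem_image_of_mem _ hm⟩
    cases m with
    | opn x => exact Finset.mem_union_left _ (Finset.mem_image_of_mem _ hvar)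
    | cls x => exact Finset.mem_union_right _ (Finset.mem_image_of_mem _ hvar)
  refine (Finset.card_le_card h₃).trans ((Finset.card_union_le _ _).trans ?_)
  rw [two_mul]
  exact Nat.add_le_add Finset.card_image_le Finset.card_image_le

theorem Run.Valid.length_out_le (h : ρ.Valid) : ρ.out.length ≤ 2 * A.vars.card := by
  refine le_trans ?_ h.sum_card_out_le
  rw [← List.length_map (fun t : Finset (Marker V) × ℕ => t.1.card)]
  refine List.length_le_sum_of_one_le _ fun k hk => ?_
  obtain ⟨t, ht, rfl⟩ := List.mem_map.1 hk
  exact Finset.card_pos.2 (Run.mem_out.1 ht).2.2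

theorem Run.Valid.writeTime_out_le (h : ρ.Valid) : writeTime ρ.out ≤ 4 * A.vars.card + 1 := by
  have h₁ := h.sum_card_out_le
  have h₂ := h.length_out_le
  rw [writeTime, List.sum_map_add]
  simp only [List.map_const', List.sum_replicate, smul_eq_mul, mul_one]
  omega

end Mapping

end EVA

namespace EVA.Presentation

variable {α : Type u} {V : Type v} {Q : Type w} [DecidableEq α] [DecidableEq Q]
variable {A : EVA α V Q} (P : A.Presentation)

/-! ### The invariant of Evaluate -/

/-- `list_q` of `σ` denotes the elements of `R q`, each of them once. -/
def Lists (σ : State V Q) (R : Q → MarkerSeq V → Prop) : Prop :=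
  ∃ B L, σ.Represents B L ∧ ∀ p, (L p).Nodup ∧ ∀ M, M ∈ L p ↔ R p M

omit [DecidableEq Q] in
theorem next_eq_some_iff (hA : A.Deterministic) {q p : Q} {a : α} :
    P.next q a = some p ↔ (q, a, p) ∈ A.letter := by
  have hfind : ∀ t, (P.letterAdj q).find? (fun t => decide (t.1 = a)) = some t →
      (q, a, t.2) ∈ A.letter := by
    intro t ht
    have h₁ := (P.mem_letterAdj q t.1 t.2).1 (List.mem_of_find?_eq_some ht)
    have h₂ : t.1 = a := by simpa using List.find?_some ht
    rwa [h₂] at h₁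
  constructor
  · intro h
    obtain ⟨t, ht, rfl⟩ := Option.map_eq_some_iff.1 h
    exact hfind t ht
  · intro h
    have hsome : ((P.letterAdj q).find? (fun t => decide (t.1 = a))).isSome := by
      rw [List.find?_isSome]
      exact ⟨(a, p), (P.mem_letterAdj q a p).2 h, by simp⟩
    obtain ⟨t, ht⟩ := Option.isSome_iff_exists.1 hsome
    exact Option.map_eq_some_iff.2 ⟨t, ht, hA.1 _ _ _ _ (hfind t ht) h⟩

omit [DecidableEq α] in
theorem lists_initState (d : List α) : Lists P.initState (A.Reach d 0) := by
  obtain ⟨B, h⟩ := P.initState_represents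
  refine ⟨B, _, h, fun p => ?_⟩
  by_cases hp : p = A.init <;> simp [hp, Reach]

omit [DecidableEq α] in
theorem lists_capturing (hA : A.Deterministic) {d : List α} {i : ℕ} {σ : State V Q}
    (h : Lists σ (A.Reach d i)) :
    Lists (P.capturing (i + 1) σ) (A.CaptureStep (i + 1) (A.Reach d i)) := by
  obtain ⟨B, L, h₁, h₂⟩ := h
  obtain ⟨B', L', h₃, h₄⟩ := P.capturing_represents (i + 1) h₁
  refine ⟨B', L', h₃, fun p => ⟨(h₄ p).nodup_iff.2 ?_, fun M => (h₄ p).mem_iff.trans ?_⟩⟩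
  · have hmem : ∀ q M, M ∈ ((P.captureAdj q).flatMap fun t =>
        if t.2 = p then (L q).map (· ++ [(t.1, i + 1)]) else []) →
        ∃ S N, M = N ++ [(S, i + 1)] ∧ A.Reach d i q N := by
      intro q M hM
      obtain ⟨t, _, hM⟩ := List.mem_flatMap.1 hM
      split_ifs at hM
      · obtain ⟨N, hN, rfl⟩ := List.mem_map.1 hM
        exact ⟨t.1, N, rfl, ((h₂ q).2 N).1 hN⟩
      · simp at hM
    -- Repetitions are excluded within one node by cancelling the last pair, between transitions
    -- from one state to `p` by their marker sets, between source states by `Reach.state_unique`,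
    -- and between new and old entries by the position `i + 1`.
    refine List.nodup_append'.2 ⟨List.nodup_flatMap.2 ⟨fun q _ => List.nodup_flatMap.2
      ⟨fun t _ => ?_, (P.captureAdj_nodup q).imp ?_⟩, P.states_nodup.imp ?_⟩, (h₂ p).1, ?_⟩
    · split_ifs
      · exact (h₂ q).1.map (List.append_left_injective _)
      · exact List.nodup_nil
    · rintro t t' hne M hM hM'
      dsimp only at hM hM'
      split_ifs at hM hM' with hp hp'
      · obtain ⟨N, _, rfl⟩ := List.mem_map.1 hM
        obtain ⟨N', _, h'⟩ := List.mem_map.1 hM'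
        simp only [List.append_singleton_inj, Prod.mk.injEq, and_true] at h'
        exact hne (Prod.ext h'.2.symm (hp.trans hp'.symm))
      all_goals simp at hM hM'
    · rintro q q' hne M hM hM'
      obtain ⟨S, N, rfl, hN⟩ := hmem q M hM
      obtain ⟨S', N', h', hN'⟩ := hmem q' _ hM'
      simp only [List.append_singleton_inj, Prod.mk.injEq, and_true] at h'
      obtain ⟨rfl, rfl⟩ := h'
      exact hne (hN.state_unique hA hN')
    · intro M hM hM'
      obtain ⟨q, _, hM⟩ := List.mem_flatMap.1 hM
      obtain ⟨S, N, rfl, _⟩ := hmem q M hM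
      exact not_reach_append (((h₂ p).2 _).1 hM')
  · rw [List.mem_append, or_comm, (h₂ p).2]
    refine or_congr_right ?_
    simp only [List.mem_flatMap, P.mem_states, true_and, Prod.exists, P.mem_captureAdj]
    constructor
    · rintro ⟨q, S, p', hq, hM⟩
      split_ifs at hM with hp
      · obtain ⟨N, hN, rfl⟩ := List.mem_map.1 hM
        exact ⟨q, S, N, ((h₂ q).2 N).1 hN, hp ▸ hq, rfl⟩
      · simp at hM
    · rintro ⟨q, S, N, hN, hq, rfl⟩
      refine ⟨q, S, p, hq, ?_⟩
      rw [if_pos rfl]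
      exact List.mem_map_of_mem (((h₂ q).2 N).2 hN)

/-- Merging creates no repetitions because an output determines the state after the capture, so the
merged lists are disjoint. -/
theorem lists_reading (hA : A.Deterministic) {d : List α} {i : ℕ} {a : α} (ha : d[i]? = some a)
    {σ : State V Q} (h : Lists σ (A.CaptureStep (i + 1) (A.Reach d i))) :
    Lists (P.reading a σ) (A.Reach d (i + 1)) := by
  obtain ⟨B, L, h₁, h₂⟩ := h
  obtain ⟨B', L', h₃, h₄⟩ := P.reading_represents a h₁
  refine ⟨B', L', h₃, fun p => ⟨(h₄ p).nodup_iff.2 ?_, fun M => (h₄ p).mem_iff.trans ?_⟩⟩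
  · refine List.nodup_flatMap.2 ⟨fun q _ => ?_, P.states_nodup.imp ?_⟩
    · split_ifs
      · exact (h₂ q).1
      · exact List.nodup_nil
    · rintro q q' hne M hM hM'
      dsimp only at hM hM'
      split_ifs at hM hM'
      · exact hne ((((h₂ q).2 M).1 hM).state_unique hA (fun _ _ _ h => h.state_unique hA)
          (((h₂ q').2 M).1 hM'))
      all_goals simp at hM hM'
  · simp only [List.mem_flatMap, P.mem_states, true_and, Reach, P.next_eq_some_iff hA, ha,
      Option.some.injEq, exists_and_left, exists_eq_left']
    refine exists_congr fun q => ?_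
    split_ifs with hq
    · simp [(h₂ q).2, hq]
    · simp [hq]

theorem lists_rounds (hA : A.Deterministic) {d : List α} {i : ℕ} (hi : i ≤ d.length) :
    Lists (P.rounds d i) (A.Reach d i) := by
  induction i with
  | zero => simpa [rounds] using P.lists_initState d
  | succ i ih =>
    have ha : d[i]? = some d[i] := List.getElem?_eq_getElem _
    obtain ⟨B, L, h₁, h₂⟩ := P.lists_reading hA ha (P.lists_capturing hA (ih (by omega)))
    unfold rounds
    rw [ha]
    exact ⟨B, L, h₁.congr rfl rfl rfl, h₂⟩

theorem invariant (hA : A.Deterministic) {d : List α} {i : ℕ} (hi : i ≤ d.length) (p : Q)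
    (M : MarkerSeq V) :
    (∃ ρ : A.Run (d.take i), ρ.last = p ∧ ρ.out = M) ↔
      ((P.afterCapturing d i).list p ≠ none ∧
        EnumAllOutputs (P.afterCapturing d i) ((P.afterCapturing d i).list p) M) := by
  obtain ⟨B, L, h₁, h₂⟩ := P.lists_capturing hA (P.lists_rounds hA hi)
  have hd := h₁.denotes p
  rw [exists_run_iff hi, ← (h₂ p).2, afterCapturing, enumAllOutputs_iff hd]
  refine ⟨fun hM => ⟨fun hnone => ?_, hM⟩, And.right⟩
  rw [hnone] at hd
  rw [hd.eq_nil] at hM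
  simp at hM

theorem enumeration [DecidableEq V] (hA : A.Deterministic) (hS : A.Sequential) (d : List α) :
    ∃ t, Trace (P.evaluate d).1 ⟨(P.evaluate d).2, []⟩ t ∧
      ((outputs t).map MarkerSeq.toMapping).Nodup ∧
      (∀ μ : SMapping V, μ ∈ (outputs t).map MarkerSeq.toMapping ↔ μ ∈ A.sem d) ∧
      ∀ k ∈ delays 0 t, k ≤ 8 * (A.vars.card + 1) := by
  obtain ⟨B, L, h₁, h₂⟩ := P.lists_capturing hA (P.lists_rounds hA le_rfl)
  have hrun : ∀ p M, M ∈ L p ↔ ∃ ρ : A.Run d, ρ.last = p ∧ ρ.out = M := by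
    intro p M
    have := exists_run_iff (A := A) (d := d) le_rfl p M
    rw [List.take_length] at this
    rw [(h₂ p).2, this]
  have hvalid : ∀ q ∈ (P.evaluate d).2, ∀ M ∈ L q,
      ∃ ρ : A.Run d, ρ.Valid ∧ ρ.Accepting ∧ ρ.out = M := by
    intro q hq M hM
    obtain ⟨ρ, rfl, rfl⟩ := (hrun q M).1 hM
    have hacc : ρ.Accepting := (P.mem_finals _).1 (List.mem_filter.1 hq).1
    exact ⟨ρ, hS d ρ hacc, hacc, rfl⟩
  have hev : (P.evaluate d).1.Represents B L := h₁.congr rfl rfl rfl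
  obtain ⟨t, h₃, h₄, h₅⟩ := exists_enumerate_trace hev (P.evaluate d).2
    (fun q hq => of_decide_eq_true (List.mem_filter.1 hq).2)
    (2 * A.vars.card) (4 * A.vars.card + 1) (fun q hq M hM => by
      obtain ⟨ρ, hρ, _, rfl⟩ := hvalid q hq M hM
      exact ⟨hρ.length_out_le, hρ.writeTime_out_le⟩)
  have hmem : ∀ M ∈ outputs t, ∃ ρ : A.Run d, ρ.Valid ∧ ρ.Accepting ∧ ρ.out = M := by
    intro M hM
    rw [h₄] at hM
    obtain ⟨q, hq, hM⟩ := List.mem_flatMap.1 hM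
    exact hvalid q hq M hM
  refine ⟨t, h₃, ?_, fun μ => ⟨?_, ?_⟩, fun k hk => ?_⟩
  -- Decoding is injective on these outputs because they come from valid runs; lists of different
  -- final states are disjoint because an output determines its last state.
  · refine List.Nodup.map_on (fun M hM M' hM' h => ?_) ?_
    · obtain ⟨ρ, hρ, _, rfl⟩ := hmem M hM
      obtain ⟨ρ', hρ', _, rfl⟩ := hmem M' hM'
      exact hρ.out_eq hρ' h
    · rw [h₄]
      refine List.nodup_flatMap.2 ⟨fun q _ => (h₂ q).1,
        (P.finals_nodup.filter _).imp fun {q q'} hne M hM hM' => hne ?_⟩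
      exact (((h₂ q).2 M).1 hM).state_unique hA (fun _ _ _ h => h.state_unique hA)
        (((h₂ q').2 M).1 hM')
  · intro hμ
    obtain ⟨M, hM, rfl⟩ := List.mem_map.1 hμ
    obtain ⟨ρ, hρ, hacc, rfl⟩ := hmem M hM
    exact ⟨ρ, hρ, hacc, hρ.defines⟩
  · rintro ⟨ρ, hρ, hacc, hμ⟩
    rw [hμ.unique hρ.defines]
    refine List.mem_map_of_mem ?_
    have hM : ρ.out ∈ L ρ.last := (hrun _ _).2 ⟨ρ, rfl, rfl⟩
    rw [h₄]
    refine List.mem_flatMap.2 ⟨ρ.last, List.mem_filter.2 ⟨(P.mem_finals _).2 hacc, ?_⟩, hM⟩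
    rw [decide_eq_true_eq]
    intro hnone
    have hd := h₁.denotes ρ.last
    rw [show (P.capturing (d.length + 1) (P.rounds d d.length)).list ρ.last = none from hnone]
      at hd
    rw [hd.eq_nil] at hM
    simp at hM
  -- With `v = A.vars.card`, `N = 2v` and `W = 4v + 1`, the bound `2N + 3 + W` equals `8v + 4`.
  · refine ((h₅ 0 (Nat.zero_le _)).delays_le (by omega) k hk).trans ?_
    omega

end EVA.Presentation

end Spanner

theorem lemma1 :
    ∃ c : ℕ, ∀ (α V Q : Type*) [Finite α] [DecidableEq α] [DecidableEq V] [DecidableEq Q]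
      [Fintype Q] (A : Spanner.EVA α V Q) (P : A.Presentation),
      A.Deterministic → A.Sequential → ∀ d : List α,
        -- the preprocessing takes linear time
        (P.evaluate d).1.time ≤ c * A.size * (d.length + 1) ∧
        -- the invariant
        (∀ i ≤ d.length, ∀ (p : Q) (M : Spanner.MarkerSeq V),
          (∃ ρ : A.Run (d.take i), ρ.last = p ∧ ρ.out = M) ↔
            ((P.afterCapturing d i).list p ≠ none ∧
              Spanner.EnumAllOutputs (P.afterCapturing d i)
                ((P.afterCapturing d i).list p) M)) ∧
        -- the enumeration ends, outputs each mapping exactly once, and has small delay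
        (∃ t, Spanner.Trace (P.evaluate d).1 ⟨(P.evaluate d).2, []⟩ t ∧
          ((Spanner.outputs t).map Spanner.MarkerSeq.toMapping).Nodup ∧
          (∀ μ : Spanner.SMapping V,
            μ ∈ (Spanner.outputs t).map Spanner.MarkerSeq.toMapping ↔ μ ∈ A.sem d) ∧
          (∀ k ∈ Spanner.delays 0 t, k ≤ c * (A.vars.card + 1))) := by
  refine ⟨8, fun α V Q _ _ _ _ _ A P hA hS d => ⟨P.time_evaluate_le d, fun i hi => ?_, ?_⟩⟩
  · exact P.invariant hA hi
  · exact P.enumeration hA hS d
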